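/- Let $\alpha>0$, let $M$ be a real number with $M^2>0$ and $M^2\neq 1$ (so $M\ne 1$ for $M>0$), and let $\nu\in\mathbb C$ be either root of $\nu(\nu+1)=\tfrac34-M^2$, i.e. $\nu=-\tfrac12\pm\sqrt{1-M^2}$. For $\sigma=l+\tfrac12$ with $l\in\mathbb N_0$, let $T_\nu^\sigma$ be the Ferrer function: the analytic function on $\mathbb C\setminus\big((-\infty,-1]\cup[1,\infty)\big)$ with $T_\nu^\sigma(z)=e^{\mp i\sigma\pi/2}P_\nu^\sigma(z)$ for $|z-1|<2$, $\pm\operatorname{Im}z>0$, where $$P_\nu^\sigma(z)=\frac{\Gamma(\nu+\sigma+1)}{\Gamma(\nu-\sigma+1)\,\Gamma(1+\sigma)}\left(\frac{z-1}{z+1}\right)^{\sigma/2}{}_2F_1\!\left(-\nu,\nu+1;1+\sigma;\frac{1-z}{2}\right)$$ with the principal branch of the power. Put $\gamma_l=\Gamma(-\nu-l-\tfrac12)\,\Gamma(\nu-l+\tfrac12)$, and $N(\nu)=1$ if $\nu\in\mathbb R$, $N(\nu)=-i$ if $\operatorname{Im}\nu>0$, $N(\nu)=i$ if $\operatorname{Im}\nu<0$.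 Let $Y_l^m$ ($l\in\mathbb N_0$, $m\in\mathbb Z$, $|m|\le l$) be the usual spherical harmonics, orthonormal on the unit sphere. For $t\in\mathbb R$, $\theta\in[0,\pi]$, $\varphi\in[0,2\pi]$ define the positive-energy and negative-energy modes $$u_{l,m}(t,\theta,\varphi)=\sqrt{\frac{\gamma_l}{2\alpha}}\,N(\nu)\,\frac{T_\nu^{l+\frac12}(i\sinh(t/\alpha))}{\sqrt{\cosh(t/\alpha)}}\,Y_l^m(\theta,\varphi),\qquad v_{l,m}(t,\theta,\varphi)=\sqrt{\frac{\gamma_l}{2\alpha}}\,N(\nu)\,\frac{T_\nu^{l+\frac12}(-i\sinh(t/\alpha))}{\sqrt{\cosh(t/\alpha)}}\,Y_l^m(\theta,\varphi)$$ (principal square roots), and the Klein–Gordon form on the slice of constant $t$ $$\langle f,g\rangle=i\,\alpha^2\cosh^2(t/\alpha)\int_0^{2\pi}\!\!\int_0^{\pi}\big(f^*\,\partial_t g-(\partial_t f^*)\,g\big)\sin\theta\,d\theta\,d\varphi ,$$ where $^*$ is complex conjugation. Then for every $t\in\mathbb R$, all $l,p\in\mathbb N_0$ and all integers $m,s$ with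 $|m|\le l$, $|s|\le p$, $$\langle u_{l,m},u_{p,s}\rangle=\delta_{lp}\delta_{ms},\qquad \langle v_{l,m},v_{p,s}\rangle=-\delta_{lp}\delta_{ms},\qquad \langle u_{l,m},v_{p,s}\rangle=0 .$$ -/

import Mathlib

noncomputable section

namespace DeSitter

open scoped ComplexConjugate

/-- The associated Legendre function of degree `ν` and order `σ`, in the normalization
`P_ν^σ(z) = Γ(ν+σ+1) / (Γ(ν-σ+1) Γ(1+σ)) ((z-1)/(z+1))^{σ/2} ₂F₁(-ν, ν+1; 1+σ; (1-z)/2)`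
(for `σ ∈ ℕ` it is `(z^2-1)^{σ/2}` times the `σ`-th derivative of the Legendre function `P_ν`).
It is used only on the disc `|z - 1| < 2`, where the hypergeometric series converges. -/
def legendreP (ν σ z : ℂ) : ℂ :=
  Complex.Gamma (ν + σ + 1) / (Complex.Gamma (ν - σ + 1) * Complex.Gamma (1 + σ)) *
    ((z - 1) / (z + 1)) ^ (σ / 2) *
    ordinaryHypergeometric (-ν) (ν + 1) (1 + σ) ((1 - z) / 2)

/-- The plane without the cuts `(-∞, -1]` and `[1, ∞)`. -/
def cutPlane : Set ℂ := {z | z.im ≠ 0 ∨ (-1 < z.re ∧ z.re < 1)}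

/-- `T` is the Ferrer function of degree `ν` and order `σ` on the cut plane: it is analytic there
and `T(z) = e^{∓ iσπ/2} P_ν^σ(z)` for `|z - 1| < 2`, `± Im z > 0`. -/
def IsFerrer (ν σ : ℂ) (T : ℂ → ℂ) : Prop :=
  AnalyticOnNhd ℂ T cutPlane ∧
    ∀ z : ℂ, ‖z - 1‖ < 2 →
      (0 < z.im → T z = Complex.exp (-(Complex.I * σ * Real.pi / 2)) * legendreP ν σ z) ∧
      (z.im < 0 → T z = Complex.exp (Complex.I * σ * Real.pi / 2) * legendreP ν σ z)

/-- The Ferrer function `T_ν^σ`, as a function on the cut plane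
(its values on the cuts are irrelevant). -/
def ferrerT (ν σ : ℂ) : ℂ → ℂ := Classical.epsilon (IsFerrer ν σ)

/-- The conditions defining the Ferrer function determine it on the cut plane. -/
theorem IsFerrer.eqOn {ν σ : ℂ} {T T' : ℂ → ℂ} (h : IsFerrer ν σ T) (h' : IsFerrer ν σ T') :
    Set.EqOn T T' cutPlane := by
  have hstar : StarConvex ℝ (0 : ℂ) cutPlane := by
    rw [starConvex_zero_iff]
    intro z hz a ha ha1
    by_cases h0 : a = 0
    · subst h0
      right
      simp
    · have hpos : 0 < a := lt_of_le_of_ne ha (Ne.symm h0)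
      rcases hz with hz | ⟨h1, h2⟩
      · left
        simpa using ⟨h0, hz⟩
      · right
        simp only [Complex.real_smul, Complex.mul_re, Complex.ofReal_re, Complex.ofReal_im,
          zero_mul, sub_zero]
        constructor <;> nlinarith
  have hconn : IsPreconnected cutPlane := by
    exact (hstar.isPathConnected (Or.inr (by simp))).isConnected.isPreconnected
  have hmem : (1 + Complex.I) ∈ cutPlane := by
    left
    simp
  refine h.1.eqOn_of_preconnected_of_eventuallyEq h'.1 hconn hmem ?_
  have hc : Continuous fun z : ℂ => ‖z - 1‖ := by fun_prop
  have ho : IsOpen ({z : ℂ | ‖z - 1‖ < 2} ∩ {z : ℂ | 0 < z.im}) :=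
    (isOpen_lt hc continuous_const).inter (isOpen_lt continuous_const Complex.continuous_im)
  filter_upwards [ho.mem_nhds (x := 1 + Complex.I) ⟨by simp, by simp⟩] with z hz
  rw [(h.2 z hz.1).1 hz.2, (h'.2 z hz.1).1 hz.2]

/-- The Legendre polynomial `P_l = (1 / (2^l l!)) (d/dx)^l (x^2 - 1)^l`. -/
def legendrePoly (l : ℕ) : Polynomial ℝ :=
  Polynomial.C ((2 ^ l * (l.factorial : ℝ))⁻¹) *
    Polynomial.derivative^[l] ((Polynomial.X ^ 2 - 1) ^ l)

/-- The spherical harmonic `Y_l^m` for `|m| ≤ l`. With `k = |m|` and the associated Legendre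
function `P_l^k(cos θ) = (-1)^k (sin θ)^k (d^k P_l)(cos θ)`, it is
`√((2l+1)/(4π) (l-k)!/(l+k)!) P_l^k(cos θ) e^{imφ}` for `m ≥ 0`, and `(-1)^k` times this
expression for `m < 0`. -/
def sphericalHarmonic (l : ℕ) (m : ℤ) (θ φ : ℝ) : ℂ :=
  ((if 0 ≤ m then (-1) ^ m.natAbs else 1 : ℝ) *
    Real.sqrt ((2 * l + 1) / (4 * Real.pi) *
      (((l - m.natAbs).factorial : ℝ) / ((l + m.natAbs).factorial : ℝ))) *
    (Real.sin θ) ^ m.natAbs *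
    (Polynomial.derivative^[m.natAbs] (legendrePoly l)).eval (Real.cos θ) : ℝ) *
  Complex.exp (Complex.I * m * φ)

/-- The phase `N(ν)`: `1` on the real axis, `-i` above it and `i` below it. -/
def phaseN (ν : ℂ) : ℂ :=
  if ν.im = 0 then 1 else if 0 < ν.im then -Complex.I else Complex.I

/-- `γ_l = Γ(-ν - l - 1/2) Γ(ν - l + 1/2)`. -/
def gammaFactor (ν : ℂ) (l : ℕ) : ℂ :=
  Complex.Gamma (-ν - l - 1 / 2) * Complex.Gamma (ν - l + 1 / 2)

/-- The positive-energy mode `u_{l,m}(t, θ, φ)`, with the principal square root of `γ_l / (2α)`. -/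
def uMode (α : ℝ) (ν : ℂ) (l : ℕ) (m : ℤ) (t θ φ : ℝ) : ℂ :=
  (gammaFactor ν l / (2 * α)) ^ (1 / 2 : ℂ) * phaseN ν *
    (ferrerT ν (l + 1 / 2) (Complex.I * Real.sinh (t / α)) / Real.sqrt (Real.cosh (t / α))) *
    sphericalHarmonic l m θ φ

/-- The negative-energy mode `v_{l,m}(t, θ, φ)`. -/
def vMode (α : ℝ) (ν : ℂ) (l : ℕ) (m : ℤ) (t θ φ : ℝ) : ℂ :=
  (gammaFactor ν l / (2 * α)) ^ (1 / 2 : ℂ) * phaseN ν *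
    (ferrerT ν (l + 1 / 2) (-(Complex.I * Real.sinh (t / α))) / Real.sqrt (Real.cosh (t / α))) *
    sphericalHarmonic l m θ φ

/-- The Klein-Gordon form evaluated on the time slice `S_t`:
`i a(t)^2 ∫ (f^* ∂_t g - (∂_t f^*) g) sin θ dθ dφ` with `a(t) = α cosh (t/α)`. -/
def kgForm (α : ℝ) (f g : ℝ → ℝ → ℝ → ℂ) (t : ℝ) : ℂ :=
  Complex.I * ((α * Real.cosh (t / α)) ^ 2 : ℝ) *
    ∫ φ in (0 : ℝ)..(2 * Real.pi), ∫ θ in (0 : ℝ)..Real.pi,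
      (conj (f t θ φ) * deriv (fun τ : ℝ => g τ θ φ) t -
        deriv (fun τ : ℝ => conj (f τ θ φ)) t * g t θ φ) * (Real.sin θ : ℂ)

end DeSitter

end

open scoped ComplexConjugate

/-! Put `μ = ν + 1/2`, so `μ² = 1 - M²` is real, less than 1, and `μ` is not an integer. The
Klein–Gordon form of two separated modes is a Wronskian in time multiplied by an inner product on
the sphere. The latter is orthonormality of the spherical harmonics, so only the time Wronskian for
a single `l` remains.

Since the order is half an odd integer, the Ferrer function is elementary: order `1/2` gives `√(2/π)
(1-z²)^(-1/4) sin (μ arccos z)`, and a first-order operator in `z` raises the order by one. This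
gives an explicit continuation to the whole cut plane; it is needed because `i sinh τ` leaves the
disc of the hypergeometric series when `cosh τ ≥ 2`. Agreement with the series (`ferrerLadder_eqOn`)
follows from a contiguous relation and `₂F₁(1/2-μ, 1/2+μ; 3/2; sin² φ) = sin (2μφ) / (2μ sin φ)`.

Let `f(τ)` be the Ferrer function at `i sinh τ`. As `μ²` is real, `conj μ = ε μ` with `ε = ±1`, and
then `conj (f τ) = ε f(-τ)` (`conj_ferrerPair`). The form therefore becomes the Wronskian of `f(τ)`
and `f(-τ)`. Raising the order multiplies this Wronskian by `(l+1)² - μ²` and divides `γ_l` by the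
same factor, so the product of the two is independent of `l`. At `l = 0` it is found from the sine
addition formula and Euler's reflection formula (`gammaFactor_mul_wronskian`). The positivity `-ε
γ_l > 0` (`exists_gammaFactor_eq`) then makes the norms `+1` and `-1`. The mixed product vanishes
because `conj u` and `v` have proportional time factors. -/

/-! ### Hypergeometric series and contiguous relations -/

theorem one_le_radius_ordinaryHypergeometricSeries (a b c : ℂ) :
    1 ≤ (ordinaryHypergeometricSeries ℂ a b c).radius := by
  by_cases h : ∀ k : ℕ, (k : ℂ) ≠ -a ∧ (k : ℂ) ≠ -b ∧ (k : ℂ) ≠ -c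
  · exact (ordinaryHypergeometricSeries_radius_eq_one ℂ a b c h).ge
  · push Not at h
    obtain ⟨k, hk⟩ := h
    -- In the exceptional cases the series is a polynomial; for the lower parameter `c` this is due
    -- to the convention `0⁻¹ = 0`.
    have key : (ordinaryHypergeometricSeries ℂ a b c).radius = ⊤ := by
      by_cases ha : (k : ℂ) = -a
      · obtain rfl : a = -(k : ℂ) := by rw [ha, neg_neg]
        exact ordinaryHypergeometric_radius_top_of_neg_nat₁ ℂ b c
      by_cases hb : (k : ℂ) = -b
      · obtain rfl : b = -(k : ℂ) := by rw [hb, neg_neg]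
        exact ordinaryHypergeometric_radius_top_of_neg_nat₂ ℂ a c
      obtain rfl : c = -(k : ℂ) := by rw [hk ha hb, neg_neg]
      exact ordinaryHypergeometric_radius_top_of_neg_nat₃ ℂ a b
    rw [key]
    exact le_top

theorem hasFPowerSeriesOnBall_ordinaryHypergeometric (a b c : ℂ) :
    HasFPowerSeriesOnBall (ordinaryHypergeometric a b c : ℂ → ℂ)
      (ordinaryHypergeometricSeries ℂ a b c) 0 1 :=
  ((ordinaryHypergeometricSeries ℂ a b c).hasFPowerSeriesOnBall
    (zero_lt_one.trans_le (one_le_radius_ordinaryHypergeometricSeries a b c))).mono zero_lt_one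
    (one_le_radius_ordinaryHypergeometricSeries a b c)

theorem mem_eball_zero_one {w : ℂ} (hw : ‖w‖ < 1) : w ∈ Metric.eball (0 : ℂ) 1 := by
  rw [Metric.mem_eball, edist_zero_right, ← ofReal_norm]
  exact ENNReal.ofReal_lt_one.2 hw

theorem hasSum_ordinaryHypergeometric (a b c : ℂ) {w : ℂ} (hw : ‖w‖ < 1) :
    HasSum (fun n : ℕ => ordinaryHypergeometricCoefficient a b c n * w ^ n)
      (ordinaryHypergeometric a b c w) := by
  have h := (hasFPowerSeriesOnBall_ordinaryHypergeometric a b c).hasSum (mem_eball_zero_one hw)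
  simp only [ordinaryHypergeometricSeries_apply_eq, smul_eq_mul, zero_add] at h
  exact h

theorem analyticAt_ordinaryHypergeometric (a b c : ℂ) {w : ℂ} (hw : ‖w‖ < 1) :
    AnalyticAt ℂ (ordinaryHypergeometric a b c : ℂ → ℂ) w :=
  (hasFPowerSeriesOnBall_ordinaryHypergeometric a b c).analyticAt_of_mem (mem_eball_zero_one hw)

theorem hasSum_deriv_ordinaryHypergeometric (a b c : ℂ) {w : ℂ} (hw : ‖w‖ < 1) :
    HasSum (fun n : ℕ => (n + 1) * ordinaryHypergeometricCoefficient a b c (n + 1) * w ^ n)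
      (deriv (ordinaryHypergeometric a b c : ℂ → ℂ) w) := by
  have h := (hasFPowerSeriesOnBall_ordinaryHypergeometric a b c).fderiv.hasSum
    (mem_eball_zero_one hw)
  have h2 := h.mapL (ContinuousLinearMap.apply ℂ ℂ (1 : ℂ))
  simp only [zero_add, ContinuousLinearMap.apply_apply, fderiv_apply_one_eq_deriv] at h2
  refine h2.congr_fun fun n => ?_
  have e : ((ordinaryHypergeometricSeries ℂ a b c).derivSeries n fun _ => w) 1 =
      w ^ n * (ordinaryHypergeometricSeries ℂ a b c).derivSeries.coeff n 1 := by
    rw [FormalMultilinearSeries.apply_eq_pow_smul_coeff]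
    simp
  rw [e, FormalMultilinearSeries.derivSeries_coeff_one,
    ordinaryHypergeometricSeries, FormalMultilinearSeries.coeff_ofScalars]
  simp only [nsmul_eq_mul]
  push_cast
  ring

theorem ordinaryHypergeometricCoefficient_succ (a b c : ℂ) (n : ℕ) :
    ordinaryHypergeometricCoefficient a b c (n + 1) * (n + 1) =
      ordinaryHypergeometricCoefficient a b c n * ((a + n) * (b + n) * (c + n)⁻¹) := by
  have h : (n : ℂ) + 1 ≠ 0 := Nat.cast_add_one_ne_zero n
  simp only [ordinaryHypergeometricCoefficient, ascPochhammer_succ_eval, Nat.factorial_succ,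
    Nat.cast_mul, mul_inv]
  push_cast
  field_simp

theorem ordinaryHypergeometricCoefficient_add_one (a b c : ℂ) (hc : ∀ k : ℕ, c + k ≠ 0) (n : ℕ) :
    ordinaryHypergeometricCoefficient a b (c + 1) n * (c + n) =
      ordinaryHypergeometricCoefficient a b c n * c := by
  have h : (ascPochhammer ℂ n).eval (c + 1) * c = (ascPochhammer ℂ n).eval c * (c + n) := by
    rw [← ascPochhammer_succ_eval, ascPochhammer_succ_left]
    simp [mul_comm]
  have h1 : (ascPochhammer ℂ n).eval c ≠ 0 := by
    rw [Ne, ascPochhammer_eval_eq_zero_iff]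
    rintro ⟨k, -, hk⟩
    exact hc k (by rw [hk]; ring)
  have h2 : (ascPochhammer ℂ n).eval (c + 1) ≠ 0 := by
    rw [Ne, ascPochhammer_eval_eq_zero_iff]
    rintro ⟨k, -, hk⟩
    exact hc (k + 1) (by push_cast; rw [hk]; ring)
  simp only [ordinaryHypergeometricCoefficient]
  have h3 : ((ascPochhammer ℂ n).eval (c + 1))⁻¹ * (c + n) =
      ((ascPochhammer ℂ n).eval c)⁻¹ * c := by
    field_simp
    linear_combination -h
  linear_combination ((n.factorial : ℂ)⁻¹ * (ascPochhammer ℂ n).eval a *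
    (ascPochhammer ℂ n).eval b) * h3

theorem hasSum_mul_deriv_ordinaryHypergeometric (a b c : ℂ) {w : ℂ} (hw : ‖w‖ < 1) :
    HasSum (fun n : ℕ => n * ordinaryHypergeometricCoefficient a b c n * w ^ n)
      (w * deriv (ordinaryHypergeometric a b c : ℂ → ℂ) w) := by
  rw [← hasSum_nat_add_iff' 1]
  simpa [pow_succ, mul_comm, mul_left_comm, mul_assoc] using
    (hasSum_deriv_ordinaryHypergeometric a b c hw).mul_left w

/-- Contiguous relation raising the lower parameter, in the case `a + b = 1`. -/
theorem ordinaryHypergeometric_contiguous_up (a b c : ℂ) (hab : a + b = 1)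
    (hc : ∀ k : ℕ, c + k ≠ 0) {w : ℂ} (hw : ‖w‖ < 1) :
    (c - a) * (c - b) * ordinaryHypergeometric a b (c + 1) w =
      c * ((1 - w) * deriv (ordinaryHypergeometric a b c : ℂ → ℂ) w +
        (c - 1) * ordinaryHypergeometric a b c w) := by
  have h1 := (((hasSum_deriv_ordinaryHypergeometric a b c hw).sub
    (hasSum_mul_deriv_ordinaryHypergeometric a b c hw)).add
    ((hasSum_ordinaryHypergeometric a b c hw).mul_left (c - 1))).mul_left c
  have h2 := (hasSum_ordinaryHypergeometric a b (c + 1) hw).mul_left ((c - a) * (c - b))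
  rw [show (1 - w) * deriv (ordinaryHypergeometric a b c : ℂ → ℂ) w =
    deriv (ordinaryHypergeometric a b c : ℂ → ℂ) w -
      w * deriv (ordinaryHypergeometric a b c : ℂ → ℂ) w by ring]
  -- The coefficients of `w ^ n` agree because `(a+n)(b+n) + (c+n)(c-1-n) = (c-a)(c-b)` when `a + b
  -- = 1`.
  refine h2.unique (h1.congr_fun fun n => ?_)
  have e1 := ordinaryHypergeometricCoefficient_succ a b c n
  have e2 := ordinaryHypergeometricCoefficient_add_one a b c hc n
  have hcn := hc n
  obtain rfl : b = 1 - a := by rw [← hab]; ring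
  generalize ordinaryHypergeometricCoefficient a (1 - a) c (n + 1) = x at *
  generalize ordinaryHypergeometricCoefficient a (1 - a) c n = y at *
  generalize ordinaryHypergeometricCoefficient a (1 - a) (c + 1) n = z at *
  obtain rfl : z = y * c / (c + n) := by rw [← e2]; field_simp
  rw [mul_comm (n + 1 : ℂ) x, e1]
  field_simp
  ring

/-- Contiguous relation lowering the lower parameter. -/
theorem ordinaryHypergeometric_contiguous_down (a b c : ℂ)
    (hc : ∀ k : ℕ, c + k ≠ 0) {w : ℂ} (hw : ‖w‖ < 1) :
    w * deriv (ordinaryHypergeometric a b (c + 1) : ℂ → ℂ) w +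
      c * ordinaryHypergeometric a b (c + 1) w = c * ordinaryHypergeometric a b c w := by
  have h1 := (hasSum_mul_deriv_ordinaryHypergeometric a b (c + 1) hw).add
    ((hasSum_ordinaryHypergeometric a b (c + 1) hw).mul_left c)
  have h2 := (hasSum_ordinaryHypergeometric a b c hw).mul_left c
  refine h1.unique (h2.congr_fun fun n => ?_)
  linear_combination w ^ n * ordinaryHypergeometricCoefficient_add_one a b c hc n

theorem norm_sin_sq_lt_one {φ : ℝ} (hφ : φ ∈ Set.Ioo (-(Real.pi / 2)) (Real.pi / 2)) :
    ‖Complex.sin φ ^ 2‖ < 1 := by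
  have h := Real.cos_pos_of_mem_Ioo hφ
  rw [← Complex.ofReal_sin, ← Complex.ofReal_pow, Complex.norm_real, Real.norm_of_nonneg (sq_nonneg _)]
  nlinarith [Real.sin_sq_add_cos_sq φ]

theorem half_add_natCast_ne_zero (k : ℕ) : (1 / 2 : ℂ) + k ≠ 0 := by
  have : (1 / 2 : ℂ) + k = ((1 / 2 + k : ℝ) : ℂ) := by push_cast; ring
  rw [this, Complex.ofReal_ne_zero]
  positivity

theorem eq_of_hasDerivAt_zero_Ioo {a b : ℝ} {f : ℝ → ℂ}
    (hf : ∀ x ∈ Set.Ioo a b, HasDerivAt f 0 x) {x y : ℝ} (hx : x ∈ Set.Ioo a b)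
    (hy : y ∈ Set.Ioo a b) : f x = f y :=
  isOpen_Ioo.is_const_of_deriv_eq_zero isPreconnected_Ioo
    (fun x hx => (hf x hx).differentiableAt.differentiableWithinAt)
    (fun x hx => (hf x hx).deriv) hx hy

/-- `₂F₁(1/2-μ, 1/2+μ; 3/2; sin² φ) = sin (2μφ) / (2μ sin φ)`. -/
theorem sin_mul_ordinaryHypergeometric (μ : ℂ) {φ : ℝ}
    (hφ : φ ∈ Set.Ioo (-(Real.pi / 2)) (Real.pi / 2)) :
    2 * μ * (Complex.sin φ * ordinaryHypergeometric (1 / 2 - μ) (1 / 2 + μ) (3 / 2)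
      (Complex.sin φ ^ 2)) = Complex.sin (2 * μ * φ) := by
  set F : ℂ → ℂ := ordinaryHypergeometric (1 / 2 - μ) (1 / 2 + μ) (1 / 2) with hF
  set G : ℂ → ℂ := ordinaryHypergeometric (1 / 2 - μ) (1 / 2 + μ) (3 / 2) with hG
  have hG' : (ordinaryHypergeometric (1 / 2 - μ) (1 / 2 + μ) (1 / 2 + 1) : ℂ → ℂ) = G := by
    rw [hG]; norm_num
  set X : ℝ → ℂ := fun φ => Complex.cos φ * F (Complex.sin φ ^ 2) with hX
  set Y : ℝ → ℂ := fun φ => 2 * μ * (Complex.sin φ * G (Complex.sin φ ^ 2)) with hY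
  -- The two contiguous relations at `c = 1/2` say exactly that `X' = -2μ Y` and `Y' = 2μ X`, a
  -- rotation starting from `X 0 = 1`, `Y 0 = 0`.
  have dsq : ∀ φ : ℝ, HasDerivAt (fun z : ℂ => Complex.sin z ^ 2)
      (2 * Complex.sin φ * Complex.cos φ) φ := fun φ => by
    exact ((Complex.hasDerivAt_sin (φ : ℂ)).pow 2).congr_deriv (by push_cast; ring)
  have dX : ∀ φ ∈ Set.Ioo (-(Real.pi / 2)) (Real.pi / 2), HasDerivAt X (-(2 * μ) * Y φ) φ := by
    intro φ hφ
    have hw := norm_sin_sq_lt_one hφ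
    have h1 := (analyticAt_ordinaryHypergeometric (1 / 2 - μ) (1 / 2 + μ) (1 / 2)
      hw).differentiableAt.hasDerivAt
    have h2 := ((Complex.hasDerivAt_cos (φ : ℂ)).mul (h1.comp (φ : ℂ) (dsq φ))).comp_ofReal
    refine h2.congr_deriv ?_
    have e := ordinaryHypergeometric_contiguous_up (1 / 2 - μ) (1 / 2 + μ) (1 / 2) (by ring)
      half_add_natCast_ne_zero hw
    rw [hG', ← hF] at e
    have cs : 1 - Complex.sin φ ^ 2 = Complex.cos φ ^ 2 := by
      linear_combination -Complex.sin_sq_add_cos_sq (φ : ℂ)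
    rw [cs] at e
    simp only [hY, Function.comp_apply]
    linear_combination (-4 * Complex.sin φ) * e
  have dY : ∀ φ ∈ Set.Ioo (-(Real.pi / 2)) (Real.pi / 2), HasDerivAt Y (2 * μ * X φ) φ := by
    intro φ hφ
    have hw := norm_sin_sq_lt_one hφ
    have h1 := (analyticAt_ordinaryHypergeometric (1 / 2 - μ) (1 / 2 + μ) (3 / 2)
      hw).differentiableAt.hasDerivAt
    have h2 := (((Complex.hasDerivAt_sin (φ : ℂ)).mul
      (h1.comp (φ : ℂ) (dsq φ))).const_mul (2 * μ)).comp_ofReal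
    refine h2.congr_deriv ?_
    have e := ordinaryHypergeometric_contiguous_down (1 / 2 - μ) (1 / 2 + μ) (1 / 2)
      half_add_natCast_ne_zero hw
    rw [hG', ← hF] at e
    simp only [hX, Function.comp_apply]
    linear_combination (4 * μ * Complex.cos φ) * e
  have ds : ∀ φ : ℝ, HasDerivAt (fun φ : ℝ => Complex.sin (2 * μ * φ))
      (2 * μ * Complex.cos (2 * μ * φ)) φ := fun φ => by
    have := ((Complex.hasDerivAt_sin _).comp (φ : ℂ)
      ((hasDerivAt_id (φ : ℂ)).const_mul (2 * μ))).comp_ofReal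
    simpa [mul_comm] using this
  have dc : ∀ φ : ℝ, HasDerivAt (fun φ : ℝ => Complex.cos (2 * μ * φ))
      (-(2 * μ) * Complex.sin (2 * μ * φ)) φ := fun φ => by
    have := ((Complex.hasDerivAt_cos _).comp (φ : ℂ)
      ((hasDerivAt_id (φ : ℂ)).const_mul (2 * μ))).comp_ofReal
    simpa [mul_comm] using this
  have h0 : (0 : ℝ) ∈ Set.Ioo (-(Real.pi / 2)) (Real.pi / 2) := by
    constructor <;> linarith [Real.pi_pos]
  -- Rotating `(X, Y)` back by the angle `2μφ` gives constants, which are evaluated at `0`.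
  have g1 : Y φ * Complex.cos (2 * μ * φ) - X φ * Complex.sin (2 * μ * φ) = 0 := by
    have := eq_of_hasDerivAt_zero_Ioo (f := fun φ : ℝ =>
      Y φ * Complex.cos (2 * μ * φ) - X φ * Complex.sin (2 * μ * φ)) (fun x hx =>
        (((dY x hx).mul (dc x)).sub ((dX x hx).mul (ds x))).congr_deriv (by ring)) hφ h0
    simpa [hX, hY] using this
  have g2 : Y φ * Complex.sin (2 * μ * φ) + X φ * Complex.cos (2 * μ * φ) = 1 := by
    have := eq_of_hasDerivAt_zero_Ioo (f := fun φ : ℝ =>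
      Y φ * Complex.sin (2 * μ * φ) + X φ * Complex.cos (2 * μ * φ)) (fun x hx =>
        (((dY x hx).mul (ds x)).add ((dX x hx).mul (dc x))).congr_deriv (by ring)) hφ h0
    simpa [hX, hY, hF, ordinaryHypergeometric_zero] using this
  change Y φ = _
  linear_combination Complex.cos (2 * μ * φ) * g1 + Complex.sin (2 * μ * φ) * g2 -
    Y φ * Complex.sin_sq_add_cos_sq (2 * μ * φ)

/-! ### Branches of `√(1-z²)` and `arccos` on the cut plane -/

theorem isOpen_cutPlane : IsOpen DeSitter.cutPlane := by
  have h1 : IsOpen {z : ℂ | z.im ≠ 0} := isOpen_ne_fun Complex.continuous_im continuous_const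
  have h2 : IsOpen {z : ℂ | -1 < z.re ∧ z.re < 1} :=
    (isOpen_lt continuous_const Complex.continuous_re).inter
      (isOpen_lt Complex.continuous_re continuous_const)
  exact h1.union h2

theorem starConvex_cutPlane : StarConvex ℝ (0 : ℂ) DeSitter.cutPlane := by
  rw [starConvex_zero_iff]
  intro z hz a ha ha1
  rcases ha.eq_or_lt with rfl | hpos
  · right
    simp
  · rcases hz with hz | ⟨h1, h2⟩
    · left
      simpa using ⟨hpos.ne', hz⟩
    · right
      simp only [Complex.real_smul, Complex.mul_re, Complex.ofReal_re, Complex.ofReal_im,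
        zero_mul, sub_zero]
      constructor <;> nlinarith

theorem one_sub_mem_slitPlane {z : ℂ} (hz : z ∈ DeSitter.cutPlane) : 1 - z ∈ Complex.slitPlane := by
  rw [Complex.mem_slitPlane_iff]
  rcases hz with hz | hz
  · right; simpa using hz
  · left; simpa using hz.2

theorem one_add_mem_slitPlane {z : ℂ} (hz : z ∈ DeSitter.cutPlane) : 1 + z ∈ Complex.slitPlane := by
  rw [Complex.mem_slitPlane_iff]
  rcases hz with hz | hz
  · right; simpa using hz
  · left; simpa using by linarith [hz.1]

theorem I_mul_ofReal_mem_cutPlane (x : ℝ) : Complex.I * x ∈ DeSitter.cutPlane := Or.inr (by simp)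

/-- The branch of `√(1 - z²)` on the cut plane that is positive on `(-1, 1)`. -/
noncomputable def sqrtOneSubSq (z : ℂ) : ℂ := Complex.exp ((Complex.log (1 - z) + Complex.log (1 + z)) / 2)

/-- The inverse of the cosine on the cut plane. -/
noncomputable def cutArccos (z : ℂ) : ℂ := -Complex.I * Complex.log (z + Complex.I * sqrtOneSubSq z)

theorem sqrtOneSubSq_ne_zero (z : ℂ) : sqrtOneSubSq z ≠ 0 := Complex.exp_ne_zero _

theorem sqrtOneSubSq_sq {z : ℂ} (hz : z ∈ DeSitter.cutPlane) :
    sqrtOneSubSq z ^ 2 = 1 - z ^ 2 := by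
  rw [sqrtOneSubSq, ← Complex.exp_nat_mul, show ((2 : ℕ) : ℂ) * ((Complex.log (1 - z) +
    Complex.log (1 + z)) / 2) = Complex.log (1 - z) + Complex.log (1 + z) by push_cast; ring,
    Complex.exp_add, Complex.exp_log (Complex.slitPlane_ne_zero (one_sub_mem_slitPlane hz)),
    Complex.exp_log (Complex.slitPlane_ne_zero (one_add_mem_slitPlane hz))]
  ring

/-- If the sum were a real `t ≤ 0`, then `t² - 2tz + 1 = 0`; hence `t ≠ 0` and `z = (t + 1/t)/2`
would be real and at most `-1`, on the cut. -/
theorem add_I_mul_sqrtOneSubSq_mem_slitPlane {z : ℂ} (hz : z ∈ DeSitter.cutPlane) :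
    z + Complex.I * sqrtOneSubSq z ∈ Complex.slitPlane := by
  by_contra h
  rw [Complex.mem_slitPlane_iff, not_or, not_lt, not_not] at h
  set t : ℝ := (z + Complex.I * sqrtOneSubSq z).re with ht
  have e : z + Complex.I * sqrtOneSubSq z = t := Complex.ext rfl (by simpa using h.2)
  have e2 : (t : ℂ) ^ 2 - 2 * t * z + 1 = 0 := by
    have : Complex.I * sqrtOneSubSq z = t - z := by rw [← e]; ring
    have h3 : (Complex.I * sqrtOneSubSq z) ^ 2 = -(1 - z ^ 2) := by
      rw [mul_pow, Complex.I_sq, sqrtOneSubSq_sq hz]; ring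
    rw [this] at h3
    linear_combination h3
  have hre := congrArg Complex.re e2
  have him := congrArg Complex.im e2
  simp [pow_two] at hre him
  have ht0 : t ≠ 0 := by
    intro h0
    simp [h0] at hre
  have ht' : t < 0 := lt_of_le_of_ne h.1 ht0
  rcases hz with hz | hz
  · rcases him with h | h
    · exact ht0 h
    · exact hz h
  · nlinarith [hz.1, hz.2, sq_nonneg (t + 1)]

theorem analyticAt_log_one_sub {z : ℂ} (hz : z ∈ DeSitter.cutPlane) :
    AnalyticAt ℂ (fun z : ℂ => Complex.log (1 - z)) z :=
  (analyticAt_const.sub analyticAt_id).clog (one_sub_mem_slitPlane hz)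

theorem analyticAt_log_one_add {z : ℂ} (hz : z ∈ DeSitter.cutPlane) :
    AnalyticAt ℂ (fun z : ℂ => Complex.log (1 + z)) z :=
  (analyticAt_const.add analyticAt_id).clog (one_add_mem_slitPlane hz)

theorem analyticAt_sqrtOneSubSq {z : ℂ} (hz : z ∈ DeSitter.cutPlane) :
    AnalyticAt ℂ sqrtOneSubSq z :=
  ((analyticAt_log_one_sub hz).add (analyticAt_log_one_add hz)).div_const.cexp

theorem analyticAt_cutArccos {z : ℂ} (hz : z ∈ DeSitter.cutPlane) :
    AnalyticAt ℂ cutArccos z :=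
  analyticAt_const.mul ((analyticAt_id.add (analyticAt_const.mul (analyticAt_sqrtOneSubSq hz))).clog
    (add_I_mul_sqrtOneSubSq_mem_slitPlane hz))

/-! ### The Ferrer function as a ladder of elementary functions -/

/-- The Ferrer function of degree `μ - 1/2` and order `l + 1/2`, by upward recursion in the
order from the elementary function of order `1/2`. -/
noncomputable def ferrerLadder (μ : ℂ) : ℕ → ℂ → ℂ
  | 0, z => (Real.sqrt (2 / Real.pi) : ℂ) *
      Complex.exp (-(Complex.log (1 - z) + Complex.log (1 + z)) / 4) * Complex.sin (μ * cutArccos z)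
  | l + 1, z => sqrtOneSubSq z * deriv (ferrerLadder μ l) z +
      (l + 1 / 2) * z / sqrtOneSubSq z * ferrerLadder μ l z

theorem ferrerLadder_succ (μ : ℂ) (l : ℕ) (z : ℂ) : ferrerLadder μ (l + 1) z =
    sqrtOneSubSq z * deriv (ferrerLadder μ l) z +
      (l + 1 / 2) * z / sqrtOneSubSq z * ferrerLadder μ l z := rfl

theorem analyticOnNhd_ferrerLadder (μ : ℂ) (l : ℕ) :
    AnalyticOnNhd ℂ (ferrerLadder μ l) DeSitter.cutPlane := by
  induction l with
  | zero =>
    intro z hz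
    exact (analyticAt_const.mul ((analyticAt_log_one_sub hz).add
      (analyticAt_log_one_add hz)).neg.div_const.cexp).mul
      (Complex.analyticAt_sin.fun_comp (analyticAt_const.mul (analyticAt_cutArccos hz)))
  | succ l ih =>
    intro z hz
    exact ((analyticAt_sqrtOneSubSq hz).mul (ih z hz).deriv).add
      (((analyticAt_const.mul analyticAt_id).div (analyticAt_sqrtOneSubSq hz)
        (sqrtOneSubSq_ne_zero z)).mul (ih z hz))

/-- `Γ(μ+l+1) / (Γ(μ-l) Γ(l+3/2))`, the prefactor of the Ferrer function. -/
noncomputable def ferrerPrefactor (μ : ℂ) (l : ℕ) : ℂ :=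
  Complex.Gamma (μ + l + 1) / (Complex.Gamma (μ - l) * Complex.Gamma (l + 3 / 2))

theorem natCast_add_three_halves_ne_zero (l : ℕ) : (l : ℂ) + 3 / 2 ≠ 0 := by
  have : (l : ℂ) + 3 / 2 = ((l + 3 / 2 : ℝ) : ℂ) := by push_cast; ring
  rw [this, Complex.ofReal_ne_zero]
  positivity

theorem ferrerPrefactor_zero {μ : ℂ} (hμ : ∀ n : ℤ, μ ≠ n) :
    ferrerPrefactor μ 0 = 2 * μ / Real.sqrt Real.pi := by
  have h0 : μ ≠ 0 := by simpa using hμ 0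
  have hG : Complex.Gamma μ ≠ 0 := Complex.Gamma_ne_zero fun m => by simpa using hμ (-m)
  have h1 : Complex.Gamma (3 / 2) = 1 / 2 * Real.sqrt Real.pi := by
    have := Complex.Gamma_add_one (1 / 2) (by norm_num)
    rw [show (1 / 2 + 1 : ℂ) = 3 / 2 by norm_num, Complex.Gamma_one_half_eq] at this
    rw [this, Real.sqrt_eq_rpow, Complex.ofReal_cpow Real.pi_pos.le]
    norm_num
  have h2 : (Real.sqrt Real.pi : ℂ) ≠ 0 := by
    simpa using (Real.sqrt_pos.2 Real.pi_pos).ne'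
  simp only [ferrerPrefactor, Nat.cast_zero, add_zero, sub_zero, zero_add, h1,
    Complex.Gamma_add_one _ h0]
  field_simp

theorem ferrerPrefactor_succ {μ : ℂ} (hμ : ∀ n : ℤ, μ ≠ n) (l : ℕ) :
    ferrerPrefactor μ (l + 1) * (l + 3 / 2) =
      ferrerPrefactor μ l * ((μ + (l + 1)) * (μ - (l + 1))) := by
  have h1 : μ + (l + 1) ≠ 0 := fun h => hμ (-(l + 1)) (by push_cast; linear_combination h)
  have h2 : μ - (l + 1) ≠ 0 := fun h => hμ (l + 1) (by push_cast; linear_combination h)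
  have g1 := Complex.Gamma_add_one _ h1
  have g2 := Complex.Gamma_add_one _ h2
  have g3 := Complex.Gamma_add_one _ (natCast_add_three_halves_ne_zero l)
  have n2 : Complex.Gamma (μ - (l + 1)) ≠ 0 := Complex.Gamma_ne_zero fun m h =>
    hμ (l + 1 - m) (by push_cast; linear_combination h)
  have n3 : Complex.Gamma ((l : ℂ) + 3 / 2) ≠ 0 := Complex.Gamma_ne_zero fun m h =>
    natCast_add_three_halves_ne_zero (l + m) (by push_cast; linear_combination h)
  have hl := natCast_add_three_halves_ne_zero l
  rw [sub_add_eq_add_sub, add_sub_add_right_eq_sub] at g2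
  simp only [ferrerPrefactor, Nat.cast_add, Nat.cast_one]
  rw [show (l : ℂ) + 1 + 3 / 2 = l + 3 / 2 + 1 by ring, g1, g2, g3,
    show μ + l + 1 = μ + (l + 1) by ring]
  generalize (l : ℂ) + 3 / 2 = c at *
  field_simp

theorem norm_one_sub_div_two_lt_one {z : ℂ} (hz : ‖z - 1‖ < 2) : ‖(1 - z) / 2‖ < 1 := by
  rw [norm_div, norm_sub_rev]
  norm_num
  linarith

theorem three_halves_add_natCast_ne_zero (l k : ℕ) : (l : ℂ) + 3 / 2 + k ≠ 0 := by
  have := natCast_add_three_halves_ne_zero (l + k)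
  push_cast at this
  rwa [add_right_comm] at this

/-- The domain where the hypergeometric series represents the Ferrer function. -/
noncomputable def ferrerSeriesDomain : Set ℂ := DeSitter.cutPlane ∩ Metric.ball 1 2

theorem isOpen_ferrerSeriesDomain : IsOpen ferrerSeriesDomain :=
  isOpen_cutPlane.inter Metric.isOpen_ball

theorem isPreconnected_ferrerSeriesDomain : IsPreconnected ferrerSeriesDomain := by
  have h : StarConvex ℝ (0 : ℂ) ferrerSeriesDomain :=
    starConvex_cutPlane.inter ((convex_ball (1 : ℂ) 2).starConvex (by simp))
  exact (h.isPathConnected ⟨Or.inr (by simp), by simp⟩).isConnected.isPreconnected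

theorem norm_sub_one_lt_of_mem {z : ℂ} (hz : z ∈ ferrerSeriesDomain) : ‖z - 1‖ < 2 := by
  simpa [dist_eq_norm] using hz.2

/-- The hypergeometric representation of the Ferrer function. -/
noncomputable def ferrerSeries (μ : ℂ) (l : ℕ) (z : ℂ) : ℂ :=
  ferrerPrefactor μ l *
    Complex.exp ((l + 1 / 2) * ((Complex.log (1 - z) - Complex.log (1 + z)) / 2)) *
    ordinaryHypergeometric (1 / 2 - μ) (1 / 2 + μ) (l + 3 / 2) ((1 - z) / 2)

theorem hasDerivAt_ferrerSeries (μ : ℂ) (l : ℕ) {z : ℂ} (hz : z ∈ ferrerSeriesDomain) :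
    HasDerivAt (ferrerSeries μ l) (ferrerPrefactor μ l *
      Complex.exp ((l + 1 / 2) * ((Complex.log (1 - z) - Complex.log (1 + z)) / 2)) *
      (-(l + 1 / 2) / (1 - z ^ 2) *
        ordinaryHypergeometric (1 / 2 - μ) (1 / 2 + μ) (l + 3 / 2) ((1 - z) / 2) -
        1 / 2 * deriv (ordinaryHypergeometric (1 / 2 - μ) (1 / 2 + μ) (l + 3 / 2) : ℂ → ℂ)
          ((1 - z) / 2))) z := by
  have s1 := one_sub_mem_slitPlane hz.1
  have s2 := one_add_mem_slitPlane hz.1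
  have n1 := Complex.slitPlane_ne_zero s1
  have n2 := Complex.slitPlane_ne_zero s2
  have n3 : 1 - z ^ 2 ≠ 0 := by
    rw [show 1 - z ^ 2 = (1 - z) * (1 + z) by ring]
    exact mul_ne_zero n1 n2
  have d1 := ((hasDerivAt_id z).const_sub 1).clog s1
  have d2 := ((hasDerivAt_id z).const_add 1).clog s2
  have dF := (analyticAt_ordinaryHypergeometric (1 / 2 - μ) (1 / 2 + μ) (l + 3 / 2)
    (norm_one_sub_div_two_lt_one (norm_sub_one_lt_of_mem hz))).differentiableAt.hasDerivAt
  have d3 := dF.comp z (((hasDerivAt_id z).const_sub 1).div_const 2)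
  refine (((((d1.sub d2).div_const 2).const_mul ((l : ℂ) + 1 / 2)).cexp.const_mul
    (ferrerPrefactor μ l)).mul d3).congr_deriv ?_
  simp only [id_eq, Function.comp_apply, Pi.sub_apply]
  rw [show 1 - z ^ 2 = (1 - z) * (1 + z) by ring]
  field_simp
  ring

theorem analyticOnNhd_ferrerSeries (μ : ℂ) (l : ℕ) :
    AnalyticOnNhd ℂ (ferrerSeries μ l) ferrerSeriesDomain :=
  DifferentiableOn.analyticOnNhd
    (fun _ hz => (hasDerivAt_ferrerSeries μ l hz).differentiableAt.differentiableWithinAt)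
    isOpen_ferrerSeriesDomain

/-- The series obeys the recursion that defines the ladder. This is the raising contiguous relation
at `w = (1-z)/2`, whose factor `(c-a)(c-b) = (l+1)² - μ²` is minus the one gained by the Gamma
prefactor. -/
theorem ferrerSeries_succ {μ : ℂ} (hμ : ∀ n : ℤ, μ ≠ n) (l : ℕ) {z : ℂ}
    (hz : z ∈ ferrerSeriesDomain) : ferrerSeries μ (l + 1) z =
    sqrtOneSubSq z * deriv (ferrerSeries μ l) z +
      (l + 1 / 2) * z / sqrtOneSubSq z * ferrerSeries μ l z := by
  rw [(hasDerivAt_ferrerSeries μ l hz).deriv]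
  have n1 := Complex.slitPlane_ne_zero (one_sub_mem_slitPlane hz.1)
  have n2 := Complex.slitPlane_ne_zero (one_add_mem_slitPlane hz.1)
  have n3 : 1 - z ^ 2 ≠ 0 := by
    rw [show 1 - z ^ 2 = (1 - z) * (1 + z) by ring]
    exact mul_ne_zero n1 n2
  have hw := norm_one_sub_div_two_lt_one (norm_sub_one_lt_of_mem hz)
  have e := ordinaryHypergeometric_contiguous_up (1 / 2 - μ) (1 / 2 + μ) (l + 3 / 2) (by ring)
    (three_halves_add_natCast_ne_zero l) hw
  have eA := ferrerPrefactor_succ hμ l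
  simp only [ferrerSeries, Nat.cast_add, Nat.cast_one]
  rw [show (l : ℂ) + 1 + 3 / 2 = l + 3 / 2 + 1 by ring]
  -- `q` is the branch of `√((1-z)/(1+z))` by which the power factor grows from `l` to `l + 1`.
  set q := Complex.exp ((Complex.log (1 - z) - Complex.log (1 + z)) / 2) with hq
  set r := sqrtOneSubSq z with hr
  have hr0 : r ≠ 0 := sqrtOneSubSq_ne_zero z
  have eq1 : q * r = 1 - z := by
    rw [hq, hr, sqrtOneSubSq, ← Complex.exp_add, ← Complex.exp_log n1]
    congr 1
    rw [Complex.exp_log n1]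
    ring
  have er : r ^ 2 = 1 - z ^ 2 := sqrtOneSubSq_sq hz.1
  have ee : Complex.exp (((l : ℂ) + 1 + 1 / 2) * ((Complex.log (1 - z) - Complex.log (1 + z)) / 2))
      = Complex.exp (((l : ℂ) + 1 / 2) * ((Complex.log (1 - z) - Complex.log (1 + z)) / 2)) * q := by
    rw [hq, ← Complex.exp_add]
    ring_nf
  rw [ee]
  generalize Complex.exp (((l : ℂ) + 1 / 2) * ((Complex.log (1 - z) - Complex.log (1 + z)) / 2)) = E
  generalize ordinaryHypergeometric (1 / 2 - μ) (1 / 2 + μ) ((l : ℂ) + 3 / 2 + 1) ((1 - z) / 2) = G1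
    at *
  generalize deriv (ordinaryHypergeometric (1 / 2 - μ) (1 / 2 + μ) ((l : ℂ) + 3 / 2) : ℂ → ℂ)
    ((1 - z) / 2) = F1 at *
  generalize ordinaryHypergeometric (1 / 2 - μ) (1 / 2 + μ) ((l : ℂ) + 3 / 2) ((1 - z) / 2) = F at *
  have hl := natCast_add_three_halves_ne_zero l
  have key : ferrerPrefactor μ (l + 1) * G1 = -ferrerPrefactor μ l *
      ((1 + z) / 2 * F1 + (l + 1 / 2) * F) := by
    refine mul_right_cancel₀ hl ?_
    linear_combination G1 * eA - ferrerPrefactor μ l * e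
  have hq' : q = (1 - z) / r := by rw [← eq1]; field_simp
  rw [hq', ← er]
  have er' : (1 - z) * (1 + z) = r ^ 2 := by rw [er]; ring
  field_simp
  linear_combination E * (1 - z) * 2 * key - (E * ferrerPrefactor μ l * F1) * er'

/-- At `z = cos 2φ` the hypergeometric argument is `sin² φ` and `arccos z = 2φ`, so the closed form
for lower parameter `3/2` applies. -/
theorem ferrerLadder_zero_cos {μ : ℂ} (hμ : ∀ n : ℤ, μ ≠ n) {φ : ℝ}
    (hφ : φ ∈ Set.Ioo 0 (Real.pi / 2)) :
    ferrerLadder μ 0 (Real.cos (2 * φ) : ℝ) = ferrerSeries μ 0 (Real.cos (2 * φ) : ℝ) := by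
  have hs : 0 < Real.sin φ := Real.sin_pos_of_pos_of_lt_pi hφ.1 (by linarith [hφ.2, Real.pi_pos])
  have hc : 0 < Real.cos φ := Real.cos_pos_of_mem_Ioo ⟨by linarith [hφ.1, Real.pi_pos], hφ.2⟩
  have h2 : (0 : ℝ) < Real.sqrt 2 := by positivity
  have e1 : 1 - Real.cos (2 * φ) = (Real.sqrt 2 * Real.sin φ) ^ 2 := by
    rw [mul_pow, Real.sq_sqrt zero_le_two, Real.cos_two_mul]
    linear_combination -2 * Real.sin_sq_add_cos_sq φ
  have e2 : 1 + Real.cos (2 * φ) = (Real.sqrt 2 * Real.cos φ) ^ 2 := by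
    rw [mul_pow, Real.sq_sqrt zero_le_two, Real.cos_two_mul]
    ring
  have l1 : Complex.log (1 - (Real.cos (2 * φ) : ℝ)) = 2 * Real.log (Real.sqrt 2 * Real.sin φ) := by
    rw [← Complex.ofReal_one, ← Complex.ofReal_sub, ← Complex.ofReal_log (e1 ▸ sq_nonneg _), e1,
      Real.log_pow]
    push_cast
    ring
  have l2 : Complex.log (1 + (Real.cos (2 * φ) : ℝ)) = 2 * Real.log (Real.sqrt 2 * Real.cos φ) := by
    rw [← Complex.ofReal_one, ← Complex.ofReal_add, ← Complex.ofReal_log (e2 ▸ sq_nonneg _), e2,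
      Real.log_pow]
    push_cast
    ring
  have hr : sqrtOneSubSq (Real.cos (2 * φ) : ℝ) = Real.sin (2 * φ) := by
    rw [sqrtOneSubSq, l1, l2, ← mul_add, mul_div_cancel_left₀ _ two_ne_zero, ← Complex.ofReal_add,
      ← Complex.ofReal_exp, Real.exp_add, Real.exp_log (by positivity), Real.exp_log (by positivity),
      Real.sin_two_mul, ← mul_assoc, mul_right_comm (Real.sqrt 2), Real.mul_self_sqrt zero_le_two]
  have ha : cutArccos (Real.cos (2 * φ) : ℝ) = 2 * φ := by
    have : ((Real.cos (2 * φ) : ℝ) : ℂ) + Complex.I * (Real.sin (2 * φ) : ℝ) =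
        Complex.exp (2 * φ * Complex.I) := by
      rw [Complex.exp_mul_I]
      push_cast
      ring
    rw [cutArccos, hr, this, Complex.log_exp]
    · linear_combination -(2 * φ : ℂ) * Complex.I_mul_I
    · simp
      linarith [hφ.1, Real.pi_pos]
    · simp
      linarith [hφ.2]
  have hF := sin_mul_ordinaryHypergeometric μ (φ := φ) ⟨by linarith [hφ.1, Real.pi_pos], hφ.2⟩
  have hw : (1 - ((Real.cos (2 * φ) : ℝ) : ℂ)) / 2 = Complex.sin φ ^ 2 := by
    rw [← Complex.ofReal_one, ← Complex.ofReal_sub, e1, mul_pow, Real.sq_sqrt zero_le_two]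
    push_cast
    ring
  rw [ferrerLadder, ferrerSeries, ha, hw, ferrerPrefactor_zero hμ, Nat.cast_zero, zero_add, zero_add,
    ← mul_assoc μ, mul_comm μ 2, ← hF, l1, l2]
  -- `p` and `q` are the positive fourth roots of `1 - z` and `1 + z`.
  set p := Complex.exp ((Real.log (Real.sqrt 2 * Real.sin φ) : ℝ) / 2) with hp
  set q := Complex.exp ((Real.log (Real.sqrt 2 * Real.cos φ) : ℝ) / 2) with hq
  have hp0 : p ≠ 0 := Complex.exp_ne_zero _
  have hq0 : q ≠ 0 := Complex.exp_ne_zero _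
  have hp2 : p * p = Real.sqrt 2 * Complex.sin φ := by
    rw [hp, ← Complex.exp_add, add_halves, ← Complex.ofReal_exp, Real.exp_log (by positivity)]
    push_cast
    ring
  have x1 : Complex.exp (-(2 * (Real.log (Real.sqrt 2 * Real.sin φ) : ℝ) +
      2 * (Real.log (Real.sqrt 2 * Real.cos φ) : ℝ)) / 4) = p⁻¹ * q⁻¹ := by
    rw [hp, hq, ← Complex.exp_neg, ← Complex.exp_neg, ← Complex.exp_add]
    ring_nf
  have x2 : Complex.exp (1 / 2 * ((2 * (Real.log (Real.sqrt 2 * Real.sin φ) : ℝ) -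
      2 * (Real.log (Real.sqrt 2 * Real.cos φ) : ℝ)) / 2)) = p * q⁻¹ := by
    rw [hp, hq, ← Complex.exp_neg, ← Complex.exp_add]
    ring_nf
  have hpi : (Real.sqrt Real.pi : ℂ) ≠ 0 := by
    simpa using (Real.sqrt_pos.2 Real.pi_pos).ne'
  rw [x1, x2, Real.sqrt_div zero_le_two]
  generalize ordinaryHypergeometric (1 / 2 - μ) (1 / 2 + μ) (3 / 2) (Complex.sin φ ^ 2) = F
  push_cast
  field_simp
  linear_combination -(μ * F) * hp2

/-- For `l = 0` agreement on `(-1, 1)` spreads by the identity theorem; afterwards both sides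
satisfy the same recursion on an open set. -/
theorem ferrerLadder_eqOn {μ : ℂ} (hμ : ∀ n : ℤ, μ ≠ n) (l : ℕ) :
    Set.EqOn (ferrerLadder μ l) (ferrerSeries μ l) ferrerSeriesDomain := by
  induction l with
  | zero =>
    refine AnalyticOnNhd.eqOn_of_preconnected_of_frequently_eq (z₀ := 0)
      ((analyticOnNhd_ferrerLadder μ 0).mono Set.inter_subset_left) (analyticOnNhd_ferrerSeries μ 0)
      isPreconnected_ferrerSeriesDomain ⟨Or.inr (by simp), by simp⟩ ?_
    have ht : Filter.Tendsto (fun x : ℝ => (x : ℂ)) (nhdsWithin 0 {0}ᶜ) (nhdsWithin 0 {0}ᶜ) := by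
      refine tendsto_nhdsWithin_of_tendsto_nhds_of_eventually_within _ ?_ ?_
      · exact (Complex.continuous_ofReal.tendsto' 0 0 (by simp)).mono_left nhdsWithin_le_nhds
      · filter_upwards [self_mem_nhdsWithin] with x hx
        simpa using hx
    refine ht.frequently (Filter.Eventually.frequently ?_)
    have hn : Set.Ioo (-1 : ℝ) 1 ∈ nhds (0 : ℝ) := Ioo_mem_nhds (by norm_num) (by norm_num)
    filter_upwards [nhdsWithin_le_nhds hn] with x hx
    have h := ferrerLadder_zero_cos hμ (φ := Real.arccos x / 2)
      ⟨by have := Real.arccos_pos.2 hx.2; positivity,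
        by linarith [Real.arccos_lt_pi.2 hx.1]⟩
    rwa [mul_div_cancel₀ _ two_ne_zero, Real.cos_arccos hx.1.le hx.2.le] at h
  | succ l ih =>
    intro z hz
    rw [ferrerLadder_succ, ferrerSeries_succ hμ l hz, ih hz,
      (ih.eventuallyEq_of_mem (isOpen_ferrerSeriesDomain.mem_nhds hz)).deriv_eq]

/-- Here `arg (1-z) < 0 ≤ arg (1+z)`, so adding `π` brings the difference of arguments into the
principal range. This shift is what the phase `e^(-iσπ/2)` in the definition of the Ferrer function
undoes. -/
theorem log_sub_one_div_add_one_of_im_pos {z : ℂ} (hz : 0 < z.im) :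
    Complex.log ((z - 1) / (z + 1)) =
      Complex.log (1 - z) - Complex.log (1 + z) + Real.pi * Complex.I := by
  have hc : z ∈ DeSitter.cutPlane := Or.inl hz.ne'
  have n1 := Complex.slitPlane_ne_zero (one_sub_mem_slitPlane hc)
  have n2 := Complex.slitPlane_ne_zero (one_add_mem_slitPlane hc)
  have e : (z - 1) / (z + 1) =
      Complex.exp (Complex.log (1 - z) - Complex.log (1 + z) + Real.pi * Complex.I) := by
    rw [Complex.exp_add, Complex.exp_sub, Complex.exp_log n1, Complex.exp_log n2,
      Complex.exp_pi_mul_I, add_comm z 1]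
    ring
  have a1 : Complex.arg (1 - z) < 0 := Complex.arg_neg_iff.2 (by simpa using hz)
  have a2 : 0 ≤ Complex.arg (1 + z) := Complex.arg_nonneg_iff.2 (by simpa using hz.le)
  have a3 := Complex.neg_pi_lt_arg (1 - z)
  have a4 := Complex.arg_le_pi (1 + z)
  rw [e, Complex.log_exp] <;> simp [Complex.log_im] <;> linarith

theorem log_sub_one_div_add_one_of_im_neg {z : ℂ} (hz : z.im < 0) :
    Complex.log ((z - 1) / (z + 1)) =
      Complex.log (1 - z) - Complex.log (1 + z) - Real.pi * Complex.I := by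
  have hc : z ∈ DeSitter.cutPlane := Or.inl hz.ne
  have n1 := Complex.slitPlane_ne_zero (one_sub_mem_slitPlane hc)
  have n2 := Complex.slitPlane_ne_zero (one_add_mem_slitPlane hc)
  have e : (z - 1) / (z + 1) =
      Complex.exp (Complex.log (1 - z) - Complex.log (1 + z) - Real.pi * Complex.I) := by
    rw [Complex.exp_sub, Complex.exp_sub, Complex.exp_log n1, Complex.exp_log n2,
      Complex.exp_pi_mul_I, add_comm z 1]
    ring
  have a1 : Complex.arg (1 + z) < 0 := Complex.arg_neg_iff.2 (by simpa using hz)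
  have a2 : 0 ≤ Complex.arg (1 - z) := Complex.arg_nonneg_iff.2 (by simpa using hz.le)
  have a3 := Complex.neg_pi_lt_arg (1 + z)
  have a4 := Complex.arg_le_pi (1 - z)
  rw [e, Complex.log_exp] <;> simp [Complex.log_im] <;> linarith

theorem isFerrer_ferrerLadder {μ : ℂ} (hμ : ∀ n : ℤ, μ ≠ n) (l : ℕ) :
    DeSitter.IsFerrer (μ - 1 / 2) (l + 1 / 2) (ferrerLadder μ l) := by
  refine ⟨analyticOnNhd_ferrerLadder μ l, fun z hz => ?_⟩
  have hP : ∀ s : ℂ, (z - 1) / (z + 1) ≠ 0 → Complex.log ((z - 1) / (z + 1)) =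
      Complex.log (1 - z) - Complex.log (1 + z) + s → DeSitter.legendreP (μ - 1 / 2) (l + 1 / 2) z =
      Complex.exp (s * (l + 1 / 2) / 2) * ferrerSeries μ l z := by
    intro s h0 hs
    rw [DeSitter.legendreP, ferrerSeries, ferrerPrefactor, Complex.cpow_def_of_ne_zero h0, hs,
      show (Complex.log (1 - z) - Complex.log (1 + z) + s) * (((l : ℂ) + 1 / 2) / 2) =
      s * (l + 1 / 2) / 2 + (l + 1 / 2) * ((Complex.log (1 - z) - Complex.log (1 + z)) / 2) by ring,
      Complex.exp_add]
    ring_nf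
  have hmem : z.im ≠ 0 → z ∈ ferrerSeriesDomain :=
    fun h => ⟨Or.inl h, by simpa [dist_eq_norm] using hz⟩
  have hne : z.im ≠ 0 → (z - 1) / (z + 1) ≠ 0 := by
    intro h
    refine div_ne_zero (fun h' => h ?_) fun h' => h ?_
    · simpa using congrArg Complex.im h'
    · simpa using congrArg Complex.im h'
  constructor
  · intro him
    rw [ferrerLadder_eqOn hμ l (hmem him.ne'), hP _ (hne him.ne')
      (log_sub_one_div_add_one_of_im_pos him), ← mul_assoc, ← Complex.exp_add]
    ring_nf
    simp
  · intro him
    rw [ferrerLadder_eqOn hμ l (hmem him.ne), hP (-(Real.pi * Complex.I)) (hne him.ne)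
      (by rw [log_sub_one_div_add_one_of_im_neg him]; ring), ← mul_assoc, ← Complex.exp_add]
    ring_nf
    simp

/-- The ladder witnesses existence, so the function chosen by `Classical.epsilon` has the defining
property, and uniqueness identifies the two. -/
theorem ferrerT_eq {μ : ℂ} (hμ : ∀ n : ℤ, μ ≠ n) (l : ℕ) {z : ℂ} (hz : z ∈ DeSitter.cutPlane) :
    DeSitter.ferrerT (μ - 1 / 2) (l + 1 / 2) z = ferrerLadder μ l z :=
  (Classical.epsilon_spec ⟨_, isFerrer_ferrerLadder hμ l⟩ :
    DeSitter.IsFerrer _ _ (DeSitter.ferrerT _ _)).eqOn (isFerrer_ferrerLadder hμ l) hz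

/-! ### The Ferrer function along `i sinh τ` -/

/-- The restriction of the Ferrer function to `i sinh τ`, together with its `τ`-derivative. -/
noncomputable def ferrerPair (μ : ℂ) : ℕ → ℝ → ℂ × ℂ
  | 0, τ => ((Real.sqrt (2 / Real.pi) : ℂ) * (Real.exp (-Real.log (Real.cosh τ) / 2) : ℝ) *
        Complex.sin (μ * (Real.pi / 2 - Complex.I * τ)),
      (Real.sqrt (2 / Real.pi) : ℂ) * (Real.exp (-Real.log (Real.cosh τ) / 2) : ℝ) *
        (-(1 / 2) * ((Real.sinh τ : ℂ) / (Real.cosh τ : ℂ)) *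
            Complex.sin (μ * (Real.pi / 2 - Complex.I * τ)) -
          Complex.I * μ * Complex.cos (μ * (Real.pi / 2 - Complex.I * τ))))
  | l + 1, τ => (-Complex.I * ((ferrerPair μ l τ).2 -
        (l + 1 / 2) * ((Real.sinh τ : ℂ) / (Real.cosh τ : ℂ)) * (ferrerPair μ l τ).1),
      -Complex.I * (-(l + 3 / 2) * ((Real.sinh τ : ℂ) / (Real.cosh τ : ℂ)) * (ferrerPair μ l τ).2 +
        (μ ^ 2 - 1 / 4 - (l + 1 / 2) * (l + 3 / 2) / (Real.cosh τ : ℂ) ^ 2) *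
          (ferrerPair μ l τ).1))

theorem ofReal_cosh_ne_zero (τ : ℝ) : (Real.cosh τ : ℂ) ≠ 0 :=
  Complex.ofReal_ne_zero.2 (Real.cosh_pos τ).ne'

theorem ofReal_cosh_sq (τ : ℝ) : (Real.cosh τ : ℂ) ^ 2 = (Real.sinh τ : ℂ) ^ 2 + 1 := by
  rw [← Complex.ofReal_pow, Real.cosh_sq]
  push_cast
  ring

theorem tanh_sq_ofReal (τ : ℝ) :
    ((Real.sinh τ : ℂ) / (Real.cosh τ : ℂ)) ^ 2 = 1 - ((Real.cosh τ : ℂ) ^ 2)⁻¹ := by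
  have h := ofReal_cosh_ne_zero τ
  field_simp
  linear_combination -ofReal_cosh_sq τ

theorem hasDerivAt_tanh_ofReal (τ : ℝ) :
    HasDerivAt (fun τ : ℝ => (Real.sinh τ : ℂ) / (Real.cosh τ : ℂ)) (1 / (Real.cosh τ : ℂ) ^ 2) τ := by
  refine ((Real.hasDerivAt_sinh τ).ofReal_comp.div (Real.hasDerivAt_cosh τ).ofReal_comp
    (ofReal_cosh_ne_zero τ)).congr_deriv ?_
  have h := ofReal_cosh_ne_zero τ
  field_simp
  linear_combination ofReal_cosh_sq τ

theorem hasDerivAt_inv_cosh_sq (τ : ℝ) :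
    HasDerivAt (fun τ : ℝ => ((Real.cosh τ : ℂ) ^ 2)⁻¹)
      (-2 * ((Real.sinh τ : ℂ) / (Real.cosh τ : ℂ)) * ((Real.cosh τ : ℂ) ^ 2)⁻¹) τ := by
  have h := ofReal_cosh_ne_zero τ
  refine (((Real.hasDerivAt_cosh τ).ofReal_comp.pow 2).inv (pow_ne_zero 2 h)).congr_deriv ?_
  simp only [Pi.pow_apply]
  push_cast at h ⊢
  field_simp

/-- The second claim is Legendre's equation in the variable `τ`. At level `l` it eliminates the
second derivative that appears when the raising operator is differentiated, so both claims climb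
together. -/
theorem hasDerivAt_ferrerPair (μ : ℂ) (l : ℕ) : ∀ τ : ℝ,
    HasDerivAt (fun τ => (ferrerPair μ l τ).1) (ferrerPair μ l τ).2 τ ∧
    HasDerivAt (fun τ => (ferrerPair μ l τ).2)
      (-((Real.sinh τ : ℂ) / (Real.cosh τ : ℂ)) * (ferrerPair μ l τ).2 +
        (μ ^ 2 - 1 / 4 - (l + 1 / 2) ^ 2 / (Real.cosh τ : ℂ) ^ 2) * (ferrerPair μ l τ).1) τ := by
  induction l with
  | zero =>
    intro τ
    have ht := tanh_sq_ofReal τ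
    have tq : ∀ x : ℂ, x / (Real.cosh τ : ℂ) ^ 2 = x * ((Real.cosh τ : ℂ) ^ 2)⁻¹ :=
      fun x => div_eq_mul_inv _ _
    have dg : HasDerivAt (fun τ : ℝ => ((Real.exp (-Real.log (Real.cosh τ) / 2) : ℝ) : ℂ))
        (-(1 / 2) * ((Real.sinh τ : ℂ) / (Real.cosh τ : ℂ)) *
          ((Real.exp (-Real.log (Real.cosh τ) / 2) : ℝ) : ℂ)) τ := by
      refine ((((Real.hasDerivAt_cosh τ).log (Real.cosh_pos τ).ne').neg.div_const
        2).exp.ofReal_comp).congr_deriv ?_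
      simp only [Pi.neg_apply]
      push_cast
      ring
    have dl : HasDerivAt (fun τ : ℝ => μ * (Real.pi / 2 - Complex.I * τ)) (-(Complex.I * μ)) τ := by
      refine ((((hasDerivAt_id τ).ofReal_comp.const_mul Complex.I).const_sub
        (Real.pi / 2 : ℂ)).const_mul μ).congr_deriv ?_
      push_cast
      ring
    have ds := (Complex.hasDerivAt_sin _).comp τ dl
    have dc := (Complex.hasDerivAt_cos _).comp τ dl
    have dk := dg.const_mul (Real.sqrt (2 / Real.pi) : ℂ)
    refine ⟨(dk.mul ds).congr_deriv ?_, (dk.mul ((((hasDerivAt_tanh_ofReal τ).const_mul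
      (-(1 / 2) : ℂ)).mul ds).sub (dc.const_mul (Complex.I * μ)))).congr_deriv ?_⟩
    · simp only [ferrerPair, Function.comp_apply]
      ring
    · simp only [ferrerPair, Nat.cast_zero, Pi.sub_apply, Pi.mul_apply,
        Function.comp_apply, tq, one_mul]
      generalize Complex.sin (μ * (Real.pi / 2 - Complex.I * τ)) = y
      generalize Complex.cos (μ * (Real.pi / 2 - Complex.I * τ)) = y'
      generalize ((Real.exp (-Real.log (Real.cosh τ) / 2) : ℝ) : ℂ) = g
      generalize (Real.sqrt (2 / Real.pi) : ℂ) = k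
      generalize (Real.sinh τ : ℂ) / (Real.cosh τ : ℂ) = t at *
      generalize ((Real.cosh τ : ℂ) ^ 2)⁻¹ = q at *
      linear_combination (-(1 / 4) * k * g * y) * ht - k * g * y * μ ^ 2 * Complex.I_sq
  | succ l ih =>
    intro τ
    obtain ⟨d1, d2⟩ := ih τ
    have dt := hasDerivAt_tanh_ofReal τ
    have dq := hasDerivAt_inv_cosh_sq τ
    refine ⟨((d2.sub ((dt.const_mul ((l : ℂ) + 1 / 2)).mul d1)).const_mul
      (-Complex.I)).congr_deriv ?_, ((((dt.const_mul (-((l : ℂ) + 3 / 2))).mul d2).add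
      (((dq.const_mul (((l : ℂ) + 1 / 2) * (l + 3 / 2))).const_sub (μ ^ 2 - 1 / 4)).mul
      d1)).const_mul (-Complex.I)).congr_deriv ?_⟩
    · simp only [ferrerPair]
      ring
    · simp only [ferrerPair, Nat.cast_add, Nat.cast_one]
      generalize (ferrerPair μ l τ).1 = x
      generalize (ferrerPair μ l τ).2 = y
      simp only [div_eq_mul_inv _ ((Real.cosh τ : ℂ) ^ 2)]
      ring

/-- The two logarithms are complex conjugates, so their sum is `2 log |1 + i sinh τ|`. -/
theorem log_one_sub_add_log_one_add_I_sinh (τ : ℝ) :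
    Complex.log (1 - Complex.I * Real.sinh τ) + Complex.log (1 + Complex.I * Real.sinh τ) =
      2 * Real.log (Real.cosh τ) := by
  have h1 : 1 - Complex.I * Real.sinh τ = conj (1 + Complex.I * Real.sinh τ) := by
    simp only [map_add, map_mul, map_one, Complex.conj_I, Complex.conj_ofReal]
    ring
  have h2 : (1 + Complex.I * Real.sinh τ).arg ≠ Real.pi := by
    rw [Ne, Complex.arg_eq_pi_iff]
    simp
  have h3 : ‖1 + Complex.I * Real.sinh τ‖ = Real.cosh τ := by
    rw [← sq_eq_sq₀ (norm_nonneg _) (Real.cosh_pos τ).le, Complex.sq_norm, Complex.normSq_apply,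
      Real.cosh_sq]
    simp only [Complex.add_re, Complex.one_re, Complex.I_mul_re, Complex.ofReal_im, neg_zero,
      add_zero, mul_one, Complex.add_im, Complex.one_im, Complex.I_mul_im, Complex.ofReal_re,
      zero_add]
    ring
  rw [h1, Complex.log_conj _ h2, add_comm, Complex.add_conj, Complex.log_re, h3]
  push_cast
  ring

theorem sqrtOneSubSq_I_sinh (τ : ℝ) : sqrtOneSubSq (Complex.I * Real.sinh τ) = Real.cosh τ := by
  rw [sqrtOneSubSq, log_one_sub_add_log_one_add_I_sinh, mul_div_cancel_left₀ _ two_ne_zero,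
    ← Complex.ofReal_exp, Real.exp_log (Real.cosh_pos τ)]

theorem cutArccos_I_sinh (τ : ℝ) :
    cutArccos (Complex.I * Real.sinh τ) = Real.pi / 2 - Complex.I * τ := by
  have h : Complex.I * Real.sinh τ + Complex.I * Real.cosh τ =
      Complex.exp (τ + Real.pi / 2 * Complex.I) := by
    rw [Complex.exp_add, Complex.exp_pi_div_two_mul_I, ← mul_add, ← Complex.ofReal_add,
      Real.sinh_add_cosh, Complex.ofReal_exp, mul_comm]
  rw [cutArccos, sqrtOneSubSq_I_sinh, h, Complex.log_exp]
  · linear_combination -(Real.pi / 2 : ℂ) * Complex.I_mul_I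
  · simp
    linarith [Real.pi_pos]
  · simp
    linarith [Real.pi_pos]

/-- Along `z = i sinh τ` one has `√(1-z²) d/dz = -i d/dτ` and `z/√(1-z²) = i tanh τ`, which turns
the ladder in `z` into the one in `τ`. -/
theorem ferrerLadder_I_sinh (μ : ℂ) (l : ℕ) (τ : ℝ) :
    ferrerLadder μ l (Complex.I * Real.sinh τ) = (ferrerPair μ l τ).1 := by
  induction l generalizing τ with
  | zero =>
    rw [ferrerLadder, log_one_sub_add_log_one_add_I_sinh, cutArccos_I_sinh, ferrerPair]
    simp only
    rw [Complex.ofReal_exp]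
    push_cast
    ring_nf
  | succ l ih =>
    have hd := (analyticOnNhd_ferrerLadder μ l _
      (I_mul_ofReal_mem_cutPlane (Real.sinh τ))).differentiableAt.hasDerivAt
    have hs : HasDerivAt (fun τ : ℝ => Complex.I * (Real.sinh τ : ℂ))
        (Complex.I * (Real.cosh τ : ℂ)) τ :=
      (Real.hasDerivAt_sinh τ).ofReal_comp.const_mul Complex.I
    have h1 := hd.comp τ hs
    have h2 : HasDerivAt (ferrerLadder μ l ∘ fun τ : ℝ => Complex.I * (Real.sinh τ : ℂ))
        (ferrerPair μ l τ).2 τ :=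
      (hasDerivAt_ferrerPair μ l τ).1.congr_of_eventuallyEq (Filter.Eventually.of_forall ih)
    have e := h1.unique h2
    rw [ferrerLadder_succ, sqrtOneSubSq_I_sinh, ih, ferrerPair, ← e]
    simp only
    linear_combination ((Real.cosh τ : ℂ) * deriv (ferrerLadder μ l) (Complex.I * Real.sinh τ)) *
      Complex.I_mul_I

/-- Conjugation sends `π/2 - iτ` to `π/2 + iτ`, that is `τ` to `-τ`, and `μ` to `ε μ`; the odd sine
yields `ε`. The raising step commutes with conjugation followed by reflection, since both `i` and
`d/dτ` change sign. -/
theorem conj_ferrerPair {μ : ℂ} {ε : ℝ} (hε : ε = 1 ∨ ε = -1) (hμ : conj μ = ε * μ) (l : ℕ)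
    (τ : ℝ) : conj (ferrerPair μ l τ).1 = ε * (ferrerPair μ l (-τ)).1 ∧
      conj (ferrerPair μ l τ).2 = -ε * (ferrerPair μ l (-τ)).2 := by
  have e2 : (ε : ℂ) ^ 2 = 1 := by rcases hε with rfl | rfl <;> norm_num
  induction l with
  | zero =>
    have hs : conj (Complex.sin (μ * (Real.pi / 2 - Complex.I * τ))) =
        ε * Complex.sin (μ * (Real.pi / 2 - Complex.I * (-τ : ℝ))) := by
      rw [← Complex.sin_conj]
      simp only [map_mul, map_sub, map_div₀, hμ, Complex.conj_I, Complex.conj_ofReal, map_ofNat]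
      rcases hε with rfl | rfl
      · push_cast; ring_nf
      · rw [Complex.ofReal_neg, Complex.ofReal_one, neg_one_mul, neg_one_mul, ← Complex.sin_neg]
        push_cast; ring_nf
    have hc : conj (Complex.cos (μ * (Real.pi / 2 - Complex.I * τ))) =
        Complex.cos (μ * (Real.pi / 2 - Complex.I * (-τ : ℝ))) := by
      rw [← Complex.cos_conj]
      simp only [map_mul, map_sub, map_div₀, hμ, Complex.conj_I, Complex.conj_ofReal, map_ofNat]
      rcases hε with rfl | rfl
      · push_cast; ring_nf
      · rw [Complex.ofReal_neg, Complex.ofReal_one, neg_one_mul, ← Complex.cos_neg]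
        push_cast; ring_nf
    constructor
    · simp only [ferrerPair, map_mul, Complex.conj_ofReal, hs, Real.cosh_neg]
      ring
    · simp only [ferrerPair, map_mul, map_sub, map_neg, map_div₀, map_one, map_ofNat,
        Complex.conj_ofReal, hs, hc, hμ, Complex.conj_I, Real.cosh_neg, Real.sinh_neg,
        Complex.ofReal_neg]
      ring
  | succ l ih =>
    have hm : (ε * μ) ^ 2 = μ ^ 2 := by rw [mul_pow, e2, one_mul]
    constructor
    · simp only [ferrerPair, map_mul, map_sub, map_add, map_neg, map_div₀, map_one, map_ofNat,
        Complex.conj_ofReal, map_natCast, ih.1, ih.2, Complex.conj_I, Real.cosh_neg, Real.sinh_neg,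
        Complex.ofReal_neg]
      ring
    · simp only [ferrerPair, map_mul, map_sub, map_add, map_neg, map_div₀, map_one, map_ofNat,
        map_pow, hμ, hm,
        Complex.conj_ofReal, map_natCast, ih.1, ih.2, Complex.conj_I, Real.cosh_neg, Real.sinh_neg,
        Complex.ofReal_neg]
      ring

/-! ### The Wronskian and the sign of `γ_l` -/

/-- Recurrence for the Wronskian of the Ferrer function and its reflection. -/
theorem ferrerPair_wronskian_recurrence (μ : ℂ) (l : ℕ) (τ : ℝ) :
    (ferrerPair μ (l + 1) (-τ)).1 * (ferrerPair μ (l + 1) τ).2 +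
        (ferrerPair μ (l + 1) (-τ)).2 * (ferrerPair μ (l + 1) τ).1 =
      ((l + 1) ^ 2 - μ ^ 2) * ((ferrerPair μ l (-τ)).1 * (ferrerPair μ l τ).2 +
        (ferrerPair μ l (-τ)).2 * (ferrerPair μ l τ).1) := by
  have ht := tanh_sq_ofReal τ
  simp only [ferrerPair, Real.cosh_neg, Real.sinh_neg, Complex.ofReal_neg, neg_div,
    div_eq_mul_inv _ ((Real.cosh τ : ℂ) ^ 2)]
  generalize (ferrerPair μ l τ).1 = x
  generalize (ferrerPair μ l τ).2 = y
  generalize (ferrerPair μ l (-τ)).1 = x'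
  generalize (ferrerPair μ l (-τ)).2 = y'
  generalize (Real.sinh τ : ℂ) / (Real.cosh τ : ℂ) = t at *
  generalize ((Real.cosh τ : ℂ) ^ 2)⁻¹ = q at *
  linear_combination ((μ ^ 2 - 1 / 4 - (l + 1 / 2) * (l + 3 / 2) * q -
    (l + 1 / 2) * (l + 3 / 2) * t ^ 2) * (x' * y + y' * x)) * Complex.I_sq +
    (l + 1 / 2) * (l + 3 / 2) * (x' * y + y' * x) * ht

theorem gammaFactor_eq (μ : ℂ) (l : ℕ) : DeSitter.gammaFactor (μ - 1 / 2) l =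
    Complex.Gamma (-μ - l) * Complex.Gamma (μ - l) := by
  rw [DeSitter.gammaFactor]
  ring_nf

/-- Euler's reflection formula, with `Γ(1-μ) = -μ Γ(-μ)`. -/
theorem gammaFactor_zero_mul {μ : ℂ} (hμ : ∀ n : ℤ, μ ≠ n) :
    DeSitter.gammaFactor (μ - 1 / 2) 0 * (μ * Complex.sin (Real.pi * μ)) = -Real.pi := by
  have h0 : -μ ≠ 0 := neg_ne_zero.2 (by simpa using hμ 0)
  have hs : Complex.sin (Real.pi * μ) ≠ 0 := by
    rw [Ne, Complex.sin_eq_zero_iff]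
    rintro ⟨k, hk⟩
    have hpi : (Real.pi : ℂ) ≠ 0 := Complex.ofReal_ne_zero.2 Real.pi_ne_zero
    exact hμ k (mul_left_cancel₀ hpi (by rw [hk, mul_comm]))
  have h := Complex.Gamma_mul_Gamma_one_sub μ
  rw [show 1 - μ = -μ + 1 by ring, Complex.Gamma_add_one _ h0, eq_div_iff hs] at h
  rw [gammaFactor_eq, Nat.cast_zero, sub_zero, sub_zero]
  linear_combination -h

theorem gammaFactor_succ {μ : ℂ} (hμ : ∀ n : ℤ, μ ≠ n) (l : ℕ) :
    DeSitter.gammaFactor (μ - 1 / 2) (l + 1) * ((l + 1) ^ 2 - μ ^ 2) =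
      DeSitter.gammaFactor (μ - 1 / 2) l := by
  have h1 : -μ - (l + 1) ≠ 0 := fun h => hμ (-(l + 1)) (by push_cast; linear_combination -h)
  have h2 : μ - (l + 1) ≠ 0 := fun h => hμ (l + 1) (by push_cast; linear_combination h)
  have g1 := Complex.Gamma_add_one _ h1
  have g2 := Complex.Gamma_add_one _ h2
  rw [sub_add_eq_add_sub, add_sub_add_right_eq_sub] at g1 g2
  rw [gammaFactor_eq, gammaFactor_eq, g1, g2]
  push_cast
  ring

theorem gammaFactor_mul_wronskian {μ : ℂ} (hμ : ∀ n : ℤ, μ ≠ n) (l : ℕ) (τ : ℝ) :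
    DeSitter.gammaFactor (μ - 1 / 2) l * (Real.cosh τ *
      ((ferrerPair μ l (-τ)).1 * (ferrerPair μ l τ).2 +
        (ferrerPair μ l (-τ)).2 * (ferrerPair μ l τ).1)) = 2 * Complex.I := by
  induction l with
  | zero =>
    have hg : ((Real.exp (-Real.log (Real.cosh τ) / 2) : ℝ) : ℂ) ^ 2 * Real.cosh τ = 1 := by
      rw [← Complex.ofReal_pow, ← Complex.ofReal_mul, ← Real.exp_nat_mul]
      rw [show ((2 : ℕ) : ℝ) * (-Real.log (Real.cosh τ) / 2) = -Real.log (Real.cosh τ) by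
        push_cast; ring, Real.exp_neg, Real.exp_log (Real.cosh_pos τ),
        inv_mul_cancel₀ (Real.cosh_pos τ).ne', Complex.ofReal_one]
    have hk : (Real.sqrt (2 / Real.pi) : ℂ) ^ 2 * Real.pi = 2 := by
      rw [← Complex.ofReal_pow, Real.sq_sqrt (by positivity), ← Complex.ofReal_mul,
        div_mul_cancel₀ _ Real.pi_ne_zero, Complex.ofReal_ofNat]
    -- The arguments at `τ` and `-τ` add up to `π μ`, so the Wronskian of the order `1/2` functions
    -- is a sine of a sum.
    have hs : Complex.sin (Real.pi * μ) =
        Complex.sin (μ * (Real.pi / 2 - Complex.I * (-τ : ℝ))) *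
          Complex.cos (μ * (Real.pi / 2 - Complex.I * τ)) +
        Complex.cos (μ * (Real.pi / 2 - Complex.I * (-τ : ℝ))) *
          Complex.sin (μ * (Real.pi / 2 - Complex.I * τ)) := by
      rw [← Complex.sin_add]
      push_cast
      ring_nf
    have hG := gammaFactor_zero_mul hμ
    rw [hs] at hG
    simp only [ferrerPair, Real.cosh_neg, Real.sinh_neg, Complex.ofReal_neg,
      neg_div (Real.cosh τ : ℂ)] at hG ⊢
    generalize Complex.sin (μ * (Real.pi / 2 - Complex.I * τ)) = S at *
    generalize Complex.cos (μ * (Real.pi / 2 - Complex.I * τ)) = C at *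
    generalize Complex.sin (μ * (Real.pi / 2 - Complex.I * -τ)) = S' at *
    generalize Complex.cos (μ * (Real.pi / 2 - Complex.I * -τ)) = C' at *
    generalize ((Real.exp (-Real.log (Real.cosh τ) / 2) : ℝ) : ℂ) = g at *
    generalize (Real.sinh τ : ℂ) / (Real.cosh τ : ℂ) = t at *
    generalize (Real.sqrt (2 / Real.pi) : ℂ) = k at *
    generalize (Real.cosh τ : ℂ) = c at *
    generalize DeSitter.gammaFactor (μ - 1 / 2) 0 = G at *
    linear_combination (-Complex.I * k ^ 2 * (g ^ 2 * c)) * hG +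
      Complex.I * (g ^ 2 * c) * hk + 2 * Complex.I * hg
  | succ l ih =>
    rw [ferrerPair_wronskian_recurrence, ← ih, ← gammaFactor_succ hμ l]
    ring

/-- `-ε γ_l > 0`, where `conj μ = ε μ`. -/
theorem exists_gammaFactor_eq {μ : ℂ} (hμ : ∀ n : ℤ, μ ≠ n) {d : ℝ} (hd : d < 1)
    (hμd : μ ^ 2 = d) {ε : ℝ} (hε : ε = 1 ∨ ε = -1) (hμε : conj μ = ε * μ) (l : ℕ) :
    ∃ r : ℝ, 0 < r ∧ DeSitter.gammaFactor (μ - 1 / 2) l = -ε * r := by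
  induction l with
  | zero =>
    have h0 : μ ≠ 0 := by simpa using hμ 0
    have hG := gammaFactor_zero_mul hμ
    -- For real `μ = x` with `0 < |x| < 1`, `x sin πx > 0`; for `μ = iy` the product is `-y sinh πy
    -- < 0`.
    have hpos : ∃ r : ℝ, 0 < r ∧ μ * Complex.sin (Real.pi * μ) = ε * r := by
      rcases hε with rfl | rfl
      · obtain ⟨x, rfl⟩ := Complex.conj_eq_iff_real.1 (by simpa using hμε)
        have hx0 : x ≠ 0 := by simpa using h0
        have hx1 : |x| < 1 := by
          rw [← sq_lt_one_iff_abs_lt_one]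
          rw [← Complex.ofReal_pow, Complex.ofReal_inj] at hμd
          rwa [hμd]
        have key : 0 < |x| * Real.sin (Real.pi * |x|) :=
          mul_pos (abs_pos.2 hx0) (Real.sin_pos_of_pos_of_lt_pi
            (mul_pos Real.pi_pos (abs_pos.2 hx0)) (by nlinarith [Real.pi_pos]))
        refine ⟨x * Real.sin (Real.pi * x), ?_, by push_cast; ring⟩
        rcases abs_cases x with ⟨h, -⟩ | ⟨h, -⟩
        · rwa [h] at key
        · rw [h, mul_neg, Real.sin_neg, neg_mul_neg] at key
          exact key
      · have hre : μ.re = 0 := by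
          have := congrArg Complex.re hμε
          simp at this
          linarith
        obtain ⟨y, rfl⟩ : ∃ y : ℝ, μ = y * Complex.I := ⟨μ.im, by
          apply Complex.ext <;> simp [hre]⟩
        have hy0 : y ≠ 0 := by
          rintro rfl
          simp at h0
        have key : 0 < |y| * Real.sinh (Real.pi * |y|) :=
          mul_pos (abs_pos.2 hy0) (Real.sinh_pos_iff.2 (mul_pos Real.pi_pos (abs_pos.2 hy0)))
        refine ⟨y * Real.sinh (Real.pi * y), ?_, ?_⟩
        · rcases abs_cases y with ⟨h, -⟩ | ⟨h, -⟩
          · rwa [h] at key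
          · rw [h, mul_neg, Real.sinh_neg, neg_mul_neg] at key
            exact key
        · rw [← mul_assoc, Complex.sin_mul_I]
          push_cast
          linear_combination (y * Complex.sinh (Real.pi * y)) * Complex.I_mul_I
    obtain ⟨r, hr, e⟩ := hpos
    refine ⟨Real.pi / r, div_pos Real.pi_pos hr, ?_⟩
    have hr' : (r : ℂ) ≠ 0 := Complex.ofReal_ne_zero.2 hr.ne'
    have e2 : (ε : ℂ) ^ 2 = 1 := by rcases hε with rfl | rfl <;> norm_num
    rw [e] at hG
    generalize DeSitter.gammaFactor (μ - 1 / 2) 0 = G at *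
    push_cast
    field_simp
    linear_combination ε * hG - G * r * e2
  | succ l ih =>
    obtain ⟨r, hr, e⟩ := ih
    -- Since `d < 1`, the ratio `γ_l / γ_{l+1}` is positive and the sign found at `l = 0` persists.
    have hl : (0 : ℝ) < (l + 1) ^ 2 - d := by
      have : (0 : ℝ) ≤ l := Nat.cast_nonneg l
      nlinarith
    have hl' : (((l : ℂ) + 1) ^ 2 - d) ≠ 0 := by
      have := Complex.ofReal_ne_zero.2 hl.ne'
      push_cast at this
      exact this
    refine ⟨r / ((l + 1) ^ 2 - d), div_pos hr hl, ?_⟩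
    have h := gammaFactor_succ hμ l
    rw [hμd, e] at h
    push_cast
    rw [eq_div_of_mul_eq hl' h]
    ring

/-! ### Associated Legendre functions and spherical harmonics -/

open Polynomial in
/-- `D^m (X² - 1)^l`, for `m = l + k` a multiple of the `k`-th derivative of the Legendre
polynomial. -/
noncomputable def rodriguesDeriv (l m : ℕ) : Polynomial ℝ := derivative^[m] ((X ^ 2 - 1) ^ l)

open Polynomial in
theorem derivative_rodriguesDeriv (l m : ℕ) :
    derivative (rodriguesDeriv l m) = rodriguesDeriv l (m + 1) := by
  rw [rodriguesDeriv, rodriguesDeriv, Function.iterate_succ_apply']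

open Polynomial in
theorem rodriguesDeriv_ode (l m : ℕ) :
    (X ^ 2 - 1) * rodriguesDeriv l (m + 2) + C (2 * (m + 1 - l : ℝ)) * X * rodriguesDeriv l (m + 1) +
      C ((m + 1) * (m - 2 * l : ℝ)) * rodriguesDeriv l m = 0 := by
  -- The first-order equation for `(X² - 1)^l`; differentiating it `m + 1` times gives the claim.
  have base : (X ^ 2 - 1) * rodriguesDeriv l 1 = C (2 * (l : ℝ)) * X * rodriguesDeriv l 0 := by
    simp only [rodriguesDeriv, Function.iterate_succ_apply, Function.iterate_zero_apply]
    rcases l with _ | l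
    · simp
    · simp only [derivative_pow, derivative_sub, derivative_one, derivative_X, sub_zero]
      simp
      ring
  induction m with
  | zero =>
    have h := congrArg derivative base
    simp only [derivative_mul, derivative_rodriguesDeriv, derivative_sub, derivative_one,
      derivative_pow, derivative_X, derivative_C] at h
    simp at h ⊢
    linear_combination h
  | succ m ih =>
    have h := congrArg derivative ih
    simp only [derivative_mul, derivative_add, derivative_rodriguesDeriv, derivative_sub,
      derivative_one, derivative_pow, derivative_X, derivative_C, derivative_zero] at h
    simp [show (C 2 : ℝ[X]) = 2 from rfl] at h ⊢
    linear_combination h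

open Polynomial in
/-- Sturm-Liouville form of the associated Legendre equation. -/
theorem derivative_one_sub_sq_pow_mul_rodriguesDeriv (l k : ℕ) :
    derivative ((1 - X ^ 2) ^ (k + 1) * rodriguesDeriv l (l + (k + 1))) =
      C ((k - l) * (l + k + 1) : ℝ) * ((1 - X ^ 2) ^ k * rodriguesDeriv l (l + k)) := by
  have h := rodriguesDeriv_ode l (l + k)
  rw [derivative_mul, derivative_rodriguesDeriv, derivative_pow_succ]
  simp only [derivative_sub, derivative_one, derivative_pow, derivative_X, ← add_assoc] at h ⊢
  simp [show (C 2 : ℝ[X]) = 2 from rfl] at h ⊢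
  linear_combination (-(1 - X ^ 2) ^ k) * h

theorem integral_derivative_eval_cos_mul_sin (q : Polynomial ℝ) :
    ∫ θ in (0 : ℝ)..Real.pi, q.derivative.eval (Real.cos θ) * Real.sin θ =
      q.eval 1 - q.eval (-1) := by
  have h := intervalIntegral.integral_eq_sub_of_hasDerivAt (a := 0) (b := Real.pi)
    (f := fun θ => -q.eval (Real.cos θ))
    (f' := fun θ => q.derivative.eval (Real.cos θ) * Real.sin θ) (fun θ _ => by
      refine ((q.hasDerivAt (Real.cos θ)).comp θ (Real.hasDerivAt_cos θ)).neg.congr_deriv ?_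
      ring) (Continuous.intervalIntegrable (by fun_prop) _ _)
  rw [h]
  simp
  ring

/-- The integral over `[0, π]` of a polynomial in `cos θ` against `sin θ dθ`. -/
noncomputable def cosIntegral (q : Polynomial ℝ) : ℝ :=
  ∫ θ in (0 : ℝ)..Real.pi, q.eval (Real.cos θ) * Real.sin θ

theorem cosIntegral_add (p q : Polynomial ℝ) :
    cosIntegral (p + q) = cosIntegral p + cosIntegral q := by
  simp only [cosIntegral, Polynomial.eval_add, add_mul]
  exact intervalIntegral.integral_add (Continuous.intervalIntegrable (by fun_prop) _ _)
    (Continuous.intervalIntegrable (by fun_prop) _ _)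

theorem cosIntegral_C_mul (c : ℝ) (q : Polynomial ℝ) :
    cosIntegral (Polynomial.C c * q) = c * cosIntegral q := by
  simp only [cosIntegral, Polynomial.eval_mul, Polynomial.eval_C, mul_assoc]
  exact intervalIntegral.integral_const_mul _ _

open Polynomial in
/-- The inner product of the `k`-th associated Legendre functions (unnormalized). -/
noncomputable def rodriguesInner (l p k : ℕ) : ℝ :=
  cosIntegral ((1 - X ^ 2) ^ k * (rodriguesDeriv l (l + k) * rodriguesDeriv p (p + k)))

theorem rodriguesInner_comm (l p k : ℕ) : rodriguesInner l p k = rodriguesInner p l k := by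
  rw [rodriguesInner, rodriguesInner, mul_comm (rodriguesDeriv l _)]

open Polynomial in
-- Integration by parts: the factor `(1 - X²)^(k+1)` kills the boundary terms, and the
-- Sturm–Liouville form supplies the eigenvalue.
theorem rodriguesInner_succ (l p k : ℕ) :
    rodriguesInner l p (k + 1) = (l - k) * (l + k + 1) * rodriguesInner l p k := by
  have h := integral_derivative_eval_cos_mul_sin
    (((1 - X ^ 2) ^ (k + 1) * rodriguesDeriv l (l + (k + 1))) * rodriguesDeriv p (p + k))
  rw [derivative_mul, derivative_one_sub_sq_pow_mul_rodriguesDeriv, derivative_rodriguesDeriv] at h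
  change cosIntegral _ = _ at h
  rw [cosIntegral_add, mul_assoc, mul_assoc, cosIntegral_C_mul, mul_assoc] at h
  simp at h
  rw [rodriguesInner, rodriguesInner]
  simp only [← add_assoc, mul_assoc] at *
  linear_combination h

/-- By symmetry in `l` and `p`, the step from `k = 0` to `1` carries both eigenvalues `l(l+1)` and
`p(p+1)`, which differ; larger `k` then follow. -/
theorem rodriguesInner_of_ne {l p : ℕ} (h : l ≠ p) (k : ℕ) : rodriguesInner l p k = 0 := by
  induction k with
  | zero =>
    have h1 := rodriguesInner_succ l p 0
    have h2 := rodriguesInner_succ p l 0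
    rw [rodriguesInner_comm p l, rodriguesInner_comm p l, h1] at h2
    have h3 : ((l : ℝ) - p) * ((l + p + 1) * rodriguesInner l p 0) = 0 := by
      push_cast at h2
      linear_combination h2
    have h4 : (l : ℝ) - p ≠ 0 := sub_ne_zero.2 (by exact_mod_cast h)
    have h5 : (l + p + 1 : ℝ) ≠ 0 := by positivity
    simpa [h4, h5] using h3
  | succ k ih => rw [rodriguesInner_succ, ih, mul_zero]

theorem rodriguesInner_self_mul_factorial {l k : ℕ} (hk : k ≤ l) :
    rodriguesInner l l k * (l - k).factorial = (l + k).factorial * rodriguesInner l l 0 := by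
  induction k with
  | zero => simp [mul_comm]
  | succ k ih =>
    have e : l - k = (l - (k + 1)) + 1 := by omega
    have h := ih (by omega)
    rw [e, Nat.factorial_succ, ← e] at h
    rw [rodriguesInner_succ, ← add_assoc, Nat.factorial_succ]
    push_cast [Nat.cast_sub (show k ≤ l by omega)] at h ⊢
    linear_combination (l + k + 1 : ℝ) * h

open Polynomial in
theorem rodriguesDeriv_top (l : ℕ) : rodriguesDeriv l (l + l) = C ((2 * l).factorial : ℝ) := by
  have hm : ((X ^ 2 - 1 : ℝ[X]) ^ l).Monic := by
    refine Monic.pow ?_ l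
    simpa using monic_X_pow_sub_C (1 : ℝ) two_ne_zero
  have hd : ((X ^ 2 - 1 : ℝ[X]) ^ l).natDegree = 2 * l := by
    have : (X ^ 2 - 1 : ℝ[X]).natDegree = 2 := by
      simpa using natDegree_X_pow_sub_C (n := 2) (r := (1 : ℝ))
    rw [natDegree_pow, this, mul_comm]
  have h0 : (rodriguesDeriv l (l + l)).natDegree = 0 := by
    have := natDegree_iterate_derivative ((X ^ 2 - 1 : ℝ[X]) ^ l) (l + l)
    rw [hd] at this
    change (rodriguesDeriv l (l + l)).natDegree ≤ _ at this
    omega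
  rw [eq_C_of_natDegree_eq_zero h0, rodriguesDeriv, coeff_iterate_derivative, zero_add, ← two_mul,
    ← hd, coeff_natDegree, hm.leadingCoeff, Nat.descFactorial_self, nsmul_one]

theorem factorial_mul_prod_eq (l : ℕ) :
    ((2 * l + 1).factorial : ℝ) * ∏ i ∈ Finset.range l, (2 * (i : ℝ) + 2) / (2 * i + 3) =
      (2 ^ l * l.factorial) ^ 2 := by
  induction l with
  | zero => simp
  | succ l ih =>
    have h : (2 * l + 3 : ℝ) ≠ 0 := by positivity
    rw [Finset.prod_range_succ, show 2 * (l + 1) + 1 = 2 * l + 1 + 1 + 1 by ring,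
      Nat.factorial_succ, Nat.factorial_succ (2 * l + 1), Nat.factorial_succ l, pow_succ (2 : ℝ) l]
    have e : ((2 : ℝ) ^ l * 2 * ((l + 1 : ℕ) * l.factorial : ℕ)) ^ 2 =
      (2 ^ l * l.factorial) ^ 2 * (2 * l + 2) ^ 2 := by push_cast; ring
    rw [e, ← ih]
    push_cast
    field_simp
    ring

open Polynomial in
-- Climb to `k = l`, where the polynomial is the constant `(2l)!` and the inner product is a
-- multiple of the Wallis integral of `sin^(2l+1)`.
theorem rodriguesInner_self_zero (l : ℕ) :
    rodriguesInner l l 0 * (2 * l + 1) = 2 * (2 ^ l * l.factorial) ^ 2 := by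
  have h1 := rodriguesInner_self_mul_factorial (le_refl l)
  have h2 : rodriguesInner l l l = ((2 * l).factorial : ℝ) ^ 2 *
      (2 * ∏ i ∈ Finset.range l, (2 * (i : ℝ) + 2) / (2 * i + 3)) := by
    rw [rodriguesInner, rodriguesDeriv_top, ← C_mul, mul_comm, cosIntegral_C_mul, ← pow_two,
      cosIntegral, ← integral_sin_pow_odd]
    congr 1
    refine intervalIntegral.integral_congr fun θ _ => ?_
    simp only [eval_pow, eval_sub, eval_one, eval_X, ← Real.sin_sq]
    ring
  have h3 : ((2 * l).factorial : ℝ) ≠ 0 := Nat.cast_ne_zero.2 (Nat.factorial_ne_zero _)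
  have h4 := factorial_mul_prod_eq l
  rw [h2, Nat.sub_self, Nat.factorial_zero, Nat.cast_one, mul_one, ← two_mul] at h1
  rw [Nat.factorial_succ] at h4
  push_cast at h4
  refine mul_left_cancel₀ h3 ?_
  linear_combination -(2 * l + 1 : ℝ) * h1 + 2 * ((2 * l).factorial : ℝ) * h4

theorem integral_assocLegendre (l p k : ℕ) (hl : k ≤ l) :
    ∫ θ in (0 : ℝ)..Real.pi, (Real.sin θ ^ k *
        (Polynomial.derivative^[k] (DeSitter.legendrePoly l)).eval (Real.cos θ)) *
      (Real.sin θ ^ k * (Polynomial.derivative^[k] (DeSitter.legendrePoly p)).eval (Real.cos θ)) *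
      Real.sin θ =
        if l = p then (2 / (2 * l + 1) * ((l + k).factorial / (l - k).factorial) : ℝ) else 0 := by
  have hP : ∀ l : ℕ, Polynomial.derivative^[k] (DeSitter.legendrePoly l) =
      Polynomial.C ((2 ^ l * (l.factorial : ℝ))⁻¹) * rodriguesDeriv l (l + k) := fun l => by
    rw [DeSitter.legendrePoly, Polynomial.iterate_derivative_C_mul, ← Function.iterate_add_apply,
      add_comm k, rodriguesDeriv]
  have h : ∫ θ in (0 : ℝ)..Real.pi, (Real.sin θ ^ k *
        (Polynomial.derivative^[k] (DeSitter.legendrePoly l)).eval (Real.cos θ)) *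
      (Real.sin θ ^ k * (Polynomial.derivative^[k] (DeSitter.legendrePoly p)).eval (Real.cos θ)) *
      Real.sin θ =
      ((2 ^ l * (l.factorial : ℝ))⁻¹ * (2 ^ p * (p.factorial : ℝ))⁻¹) * rodriguesInner l p k := by
    rw [rodriguesInner, ← cosIntegral_C_mul, cosIntegral]
    refine intervalIntegral.integral_congr fun θ _ => ?_
    simp only [hP, Polynomial.eval_mul, Polynomial.eval_C, Polynomial.eval_pow,
      Polynomial.eval_sub, Polynomial.eval_one, Polynomial.eval_X, ← Real.sin_sq, ← pow_mul]
    ring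
  rw [h]
  split_ifs with hlp
  · subst hlp
    have h1 := rodriguesInner_self_mul_factorial hl
    have h2 := rodriguesInner_self_zero l
    have n1 : ((l - k).factorial : ℝ) ≠ 0 := Nat.cast_ne_zero.2 (Nat.factorial_ne_zero _)
    have n2 : (l.factorial : ℝ) ≠ 0 := Nat.cast_ne_zero.2 (Nat.factorial_ne_zero _)
    have n3 : (2 * l + 1 : ℝ) ≠ 0 := by positivity
    have n4 : (2 ^ l * l.factorial : ℝ) ≠ 0 := mul_ne_zero (by positivity) n2
    rw [eq_div_of_mul_eq n1 h1, eq_div_of_mul_eq n3 h2]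
    generalize (2 ^ l * l.factorial : ℝ) = a at *
    field_simp
  · rw [rodriguesInner_of_ne hlp, mul_zero]

theorem integral_exp_I_mul_int (n : ℤ) :
    ∫ φ in (0 : ℝ)..(2 * Real.pi), Complex.exp (Complex.I * n * φ) =
      if n = 0 then 2 * Real.pi else 0 := by
  split_ifs with h
  · subst h
    simp
  · have hc : Complex.I * n ≠ 0 := mul_ne_zero Complex.I_ne_zero (Int.cast_ne_zero.2 h)
    rw [integral_exp_mul_complex hc]
    have : Complex.I * n * ((2 * Real.pi : ℝ) : ℂ) = n * (2 * Real.pi * Complex.I) := by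
      push_cast
      ring
    rw [this, Complex.exp_int_mul_two_pi_mul_I]
    simp

/-- The spherical harmonics are orthonormal. -/
theorem sphericalHarmonic_orthonormal (l p : ℕ) (m s : ℤ) (hm : |m| ≤ (l : ℤ)) :
    ∫ φ in (0 : ℝ)..(2 * Real.pi), ∫ θ in (0 : ℝ)..Real.pi,
      conj (DeSitter.sphericalHarmonic l m θ φ) * DeSitter.sphericalHarmonic p s θ φ *
        (Real.sin θ : ℂ) = if l = p ∧ m = s then 1 else 0 := by
  set N : ℕ → ℤ → ℝ := fun l m => (if 0 ≤ m then (-1) ^ m.natAbs else 1 : ℝ) *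
    Real.sqrt ((2 * l + 1) / (4 * Real.pi) *
      (((l - m.natAbs).factorial : ℝ) / ((l + m.natAbs).factorial : ℝ))) with hN
  set Q : ℕ → ℤ → ℝ → ℝ := fun l m θ => Real.sin θ ^ m.natAbs *
    (Polynomial.derivative^[m.natAbs] (DeSitter.legendrePoly l)).eval (Real.cos θ) with hQ
  have hY : ∀ l m θ φ, DeSitter.sphericalHarmonic l m θ φ =
      ((N l m * Q l m θ : ℝ) : ℂ) * Complex.exp (Complex.I * m * φ) := fun l m θ φ => by
    simp only [DeSitter.sphericalHarmonic, hN, hQ]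
    congr 2
    ring
  have hI : ∀ θ φ : ℝ, conj (DeSitter.sphericalHarmonic l m θ φ) *
      DeSitter.sphericalHarmonic p s θ φ * (Real.sin θ : ℂ) =
      (N l m * N p s : ℝ) * Complex.exp (Complex.I * (s - m : ℤ) * φ) *
        ((Q l m θ * Q p s θ * Real.sin θ : ℝ) : ℂ) := fun θ φ => by
    have e : Complex.exp (Complex.I * (s - m : ℤ) * φ) =
        Complex.exp (-Complex.I * m * φ) * Complex.exp (Complex.I * s * φ) := by
      rw [← Complex.exp_add]
      push_cast
      ring_nf
    rw [hY, hY, map_mul, ← Complex.exp_conj, e]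
    simp only [map_mul, Complex.conj_I, Complex.conj_ofReal, map_intCast]
    push_cast
    ring
  simp only [hI, intervalIntegral.integral_const_mul, intervalIntegral.integral_mul_const,
    intervalIntegral.integral_ofReal, integral_exp_I_mul_int]
  by_cases hms : m = s
  · subst hms
    have hk : m.natAbs ≤ l := by
      rw [Int.abs_eq_natAbs] at hm
      exact_mod_cast hm
    simp only [hQ, integral_assocLegendre l p m.natAbs hk, sub_self, if_true, and_true]
    split_ifs with hlp
    · subst hlp
      have n1 : ((l - m.natAbs).factorial : ℝ) ≠ 0 := Nat.cast_ne_zero.2 (Nat.factorial_ne_zero _)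
      have n2 : ((l + m.natAbs).factorial : ℝ) ≠ 0 := Nat.cast_ne_zero.2 (Nat.factorial_ne_zero _)
      have n3 : (2 * l + 1 : ℝ) ≠ 0 := by positivity
      have hsign : (if 0 ≤ m then (-1) ^ m.natAbs else 1 : ℝ) ^ 2 = 1 := by
        split_ifs
        · rw [← pow_mul, mul_comm, pow_mul]; norm_num
        · norm_num
      have hNN : N l m * N l m = (2 * l + 1) / (4 * Real.pi) *
          (((l - m.natAbs).factorial : ℝ) / ((l + m.natAbs).factorial : ℝ)) := by
        simp only [hN]
        rw [mul_mul_mul_comm, ← pow_two, hsign, one_mul, Real.mul_self_sqrt (by positivity)]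
      have hpi := Real.pi_ne_zero
      have key : N l m * N l m * (2 * Real.pi) * (2 / (2 * l + 1) *
          ((l + m.natAbs).factorial / (l - m.natAbs).factorial)) = 1 := by
        rw [hNN]
        field_simp
        norm_num
      exact_mod_cast congrArg Complex.ofReal key
    · simp
  · rw [if_neg (sub_ne_zero.2 (Ne.symm hms)), if_neg (fun h => hms h.2)]
    simp

/-! ### The Klein–Gordon form on the modes -/

theorem kgForm_of_separated (α : ℝ) {f g : ℝ → ℝ → ℝ → ℂ} {F G : ℝ → ℂ} {F' G' : ℂ} {t : ℝ}
    {l p : ℕ} {m s : ℤ} (hm : |m| ≤ (l : ℤ))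
    (hf : ∀ τ θ φ, f τ θ φ = F τ * DeSitter.sphericalHarmonic l m θ φ)
    (hg : ∀ τ θ φ, g τ θ φ = G τ * DeSitter.sphericalHarmonic p s θ φ)
    (hF : HasDerivAt F F' t) (hG : HasDerivAt G G' t) :
    DeSitter.kgForm α f g t = Complex.I * ((α * Real.cosh (t / α)) ^ 2 : ℝ) *
      (conj (F t) * G' - conj F' * G t) * (if l = p ∧ m = s then 1 else 0) := by
  have hd : ∀ θ φ, (conj (f t θ φ) * deriv (fun τ : ℝ => g τ θ φ) t -
        deriv (fun τ : ℝ => conj (f τ θ φ)) t * g t θ φ) * (Real.sin θ : ℂ) =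
      (conj (F t) * G' - conj F' * G t) * (conj (DeSitter.sphericalHarmonic l m θ φ) *
        DeSitter.sphericalHarmonic p s θ φ * (Real.sin θ : ℂ)) := by
    intro θ φ
    have d1 : deriv (fun τ : ℝ => g τ θ φ) t = G' * DeSitter.sphericalHarmonic p s θ φ := by
      simp only [hg]
      exact (hG.mul_const _).deriv
    have d2 : deriv (fun τ : ℝ => conj (f τ θ φ)) t =
        conj F' * conj (DeSitter.sphericalHarmonic l m θ φ) := by
      simp only [hf, map_mul]
      exact (hF.star.mul_const _).deriv
    rw [d1, d2, hf, hg, map_mul]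
    ring
  rw [DeSitter.kgForm]
  simp only [hd, intervalIntegral.integral_const_mul]
  rw [sphericalHarmonic_orthonormal l p m s hm]
  ring

theorem norm_phaseN (ν : ℂ) : ‖DeSitter.phaseN ν‖ = 1 := by
  rw [DeSitter.phaseN]
  split_ifs <;> simp

/-- Only the squared modulus of the normalization enters the form, so neither the choice of square
root nor the unimodular phase matters. -/
theorem conj_mul_self_normalization (x ν : ℂ) :
    conj (x ^ (1 / 2 : ℂ) * DeSitter.phaseN ν) * (x ^ (1 / 2 : ℂ) * DeSitter.phaseN ν) = ‖x‖ := by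
  have h : (x ^ (1 / 2 : ℂ)) ^ 2 = x := by
    simp
  rw [mul_comm, Complex.mul_conj', norm_mul, norm_phaseN, mul_one, ← Complex.ofReal_pow, ← norm_pow, h]

/-- The derivative needs no explicit value: being real, its contributions cancel in the
antisymmetric form. -/
theorem exists_hasDerivAt_inv_sqrt_cosh (τ : ℝ) :
    ∃ h' : ℂ, HasDerivAt (fun τ : ℝ => ((Real.sqrt (Real.cosh τ) : ℝ) : ℂ)⁻¹) h' τ ∧
      conj h' = h' := by
  have h := ((Real.hasDerivAt_cosh τ).sqrt (Real.cosh_pos τ).ne').fun_inv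
    (Real.sqrt_pos.2 (Real.cosh_pos τ)).ne'
  refine ⟨_, by simpa only [Complex.ofReal_inv] using h.ofReal_comp, Complex.conj_ofReal _⟩

/-- The time dependence of the mode of angular momentum `l`, run forward or backward in time
according to the sign `e`. -/
noncomputable def modeTime (α : ℝ) (μ : ℂ) (l : ℕ) (e t : ℝ) : ℂ :=
  (DeSitter.gammaFactor (μ - 1 / 2) l / (2 * α)) ^ (1 / 2 : ℂ) * DeSitter.phaseN (μ - 1 / 2) *
    ((ferrerPair μ l (e * (t / α))).1 * ((Real.sqrt (Real.cosh (t / α)) : ℝ) : ℂ)⁻¹)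

theorem uMode_eq {μ : ℂ} (hμ : ∀ n : ℤ, μ ≠ n) (α : ℝ) (l : ℕ) (m : ℤ) (t θ φ : ℝ) :
    DeSitter.uMode α (μ - 1 / 2) l m t θ φ =
      modeTime α μ l 1 t * DeSitter.sphericalHarmonic l m θ φ := by
  rw [DeSitter.uMode, modeTime, ferrerT_eq hμ l (I_mul_ofReal_mem_cutPlane _),
    ferrerLadder_I_sinh, one_mul, div_eq_mul_inv (ferrerPair μ l (t / α)).1]

theorem vMode_eq {μ : ℂ} (hμ : ∀ n : ℤ, μ ≠ n) (α : ℝ) (l : ℕ) (m : ℤ) (t θ φ : ℝ) :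
    DeSitter.vMode α (μ - 1 / 2) l m t θ φ =
      modeTime α μ l (-1) t * DeSitter.sphericalHarmonic l m θ φ := by
  have h : -(Complex.I * (Real.sinh (t / α) : ℂ)) = Complex.I * (Real.sinh (-1 * (t / α)) : ℝ) := by
    rw [neg_one_mul, Real.sinh_neg]
    push_cast
    ring
  rw [DeSitter.vMode, modeTime, h, ferrerT_eq hμ l (I_mul_ofReal_mem_cutPlane _),
    ferrerLadder_I_sinh, div_eq_mul_inv (ferrerPair μ l (-1 * (t / α))).1]

theorem hasDerivAt_modeTime (α : ℝ) (μ : ℂ) (l : ℕ) (e t : ℝ) {h' : ℂ}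
    (hh : HasDerivAt (fun τ : ℝ => ((Real.sqrt (Real.cosh τ) : ℝ) : ℂ)⁻¹) h' (t / α)) :
    HasDerivAt (modeTime α μ l e)
      ((DeSitter.gammaFactor (μ - 1 / 2) l / (2 * α)) ^ (1 / 2 : ℂ) * DeSitter.phaseN (μ - 1 / 2) *
        (e * (ferrerPair μ l (e * (t / α))).2 * ((Real.sqrt (Real.cosh (t / α)) : ℝ) : ℂ)⁻¹ +
          (ferrerPair μ l (e * (t / α))).1 * h') / α) t := by
  have d0 : HasDerivAt (fun t : ℝ => t / α) (1 / α) t := (hasDerivAt_id t).div_const α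
  have d1 := (hasDerivAt_ferrerPair μ l (e * (t / α))).1.scomp t (d0.const_mul e)
  have d2 := hh.scomp t d0
  refine ((d1.mul d2).const_mul _).congr_deriv ?_
  simp only [Function.comp_apply, Complex.real_smul]
  push_cast
  ring

theorem inv_sqrt_cosh_sq_mul_cosh (τ : ℝ) :
    ((Real.sqrt (Real.cosh τ) : ℝ) : ℂ)⁻¹ ^ 2 * Real.cosh τ = 1 := by
  rw [inv_pow, ← Complex.ofReal_pow, Real.sq_sqrt (Real.cosh_pos τ).le,
    inv_mul_cancel₀ (ofReal_cosh_ne_zero τ)]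

theorem exists_hasDerivAt_modeTime_kleinGordon {α : ℝ} (hα : 0 < α) {μ : ℂ}
    (hμ : ∀ n : ℤ, μ ≠ n) {d : ℝ} (hd : d < 1) (hμd : μ ^ 2 = d) {ε : ℝ} (hε : ε = 1 ∨ ε = -1)
    (hμε : conj μ = ε * μ) (l : ℕ) (t : ℝ) : ∃ U' V' : ℂ,
    HasDerivAt (modeTime α μ l 1) U' t ∧ HasDerivAt (modeTime α μ l (-1)) V' t ∧
    Complex.I * ((α * Real.cosh (t / α)) ^ 2 : ℝ) *
      (conj (modeTime α μ l 1 t) * U' - conj U' * modeTime α μ l 1 t) = 1 ∧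
    Complex.I * ((α * Real.cosh (t / α)) ^ 2 : ℝ) *
      (conj (modeTime α μ l (-1) t) * V' - conj V' * modeTime α μ l (-1) t) = -1 ∧
    conj (modeTime α μ l 1 t) * V' - conj U' * modeTime α μ l (-1) t = 0 := by
  obtain ⟨h', hh, hh'⟩ := exists_hasDerivAt_inv_sqrt_cosh (t / α)
  refine ⟨_, _, hasDerivAt_modeTime α μ l 1 t hh, hasDerivAt_modeTime α μ l (-1) t hh, ?_⟩
  obtain ⟨r, hr, hγ⟩ := exists_gammaFactor_eq hμ hd hμd hε hμε l
  have hW := gammaFactor_mul_wronskian hμ l (t / α)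
  have hc := conj_mul_self_normalization (DeSitter.gammaFactor (μ - 1 / 2) l / (2 * α)) (μ - 1 / 2)
  have hnorm : ‖DeSitter.gammaFactor (μ - 1 / 2) l / (2 * α)‖ = r / (2 * α) := by
    rw [hγ, norm_div, norm_mul, norm_neg, norm_mul, Complex.norm_real, Complex.norm_real,
      Complex.norm_real, Real.norm_of_nonneg hr.le, Real.norm_of_nonneg hα.le]
    rcases hε with rfl | rfl <;> simp
  rw [hnorm] at hc
  rw [hγ] at hW
  have hq := inv_sqrt_cosh_sq_mul_cosh (t / α)
  obtain ⟨c1, c2⟩ := conj_ferrerPair hε hμε l (t / α)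
  obtain ⟨c3, c4⟩ := conj_ferrerPair hε hμε l (-(t / α))
  rw [neg_neg] at c3 c4
  have hα' : (α : ℂ) ≠ 0 := Complex.ofReal_ne_zero.2 hα.ne'
  have hI := Complex.I_sq
  simp only [modeTime, one_mul, neg_one_mul, Complex.ofReal_one, Complex.ofReal_neg,
    map_mul conj (_ * DeSitter.phaseN (μ - 1 / 2)), map_div₀ conj (_ * _) (α : ℂ),
    map_add, Complex.conj_ofReal]
  simp only [map_mul conj (ferrerPair _ _ _).1, map_mul conj (ferrerPair _ _ _).2,
    map_mul conj (-(ferrerPair _ _ _).2), map_neg, map_inv₀, Complex.conj_ofReal, c1, c2, c3, c4,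
    hh']
  generalize (DeSitter.gammaFactor (μ - 1 / 2) l / (2 * α)) ^ (1 / 2 : ℂ) *
    DeSitter.phaseN (μ - 1 / 2) = c at *
  generalize conj c = c' at *
  generalize (ferrerPair μ l (t / α)).1 = x at *
  generalize (ferrerPair μ l (t / α)).2 = y at *
  generalize (ferrerPair μ l (-(t / α))).1 = x' at *
  generalize (ferrerPair μ l (-(t / α))).2 = y' at *
  generalize ((Real.sqrt (Real.cosh (t / α)) : ℝ) : ℂ)⁻¹ = h at *
  rw [Complex.ofReal_pow, Complex.ofReal_mul]
  generalize (Real.cosh (t / α) : ℂ) = C at *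
  have hc2 : c' * c * α = r / 2 := by
    rw [hc]
    push_cast
    field_simp
  -- All three products reduce to this Wronskian: `u` gives it, `v` its negative because time is
  -- reversed, and in the mixed product the terms cancel.
  have key : Complex.I * (c' * c * α) * (h ^ 2 * C) * C * ε * (x' * y + y' * x) = 1 := by
    rw [hc2, hq]
    linear_combination (-Complex.I / 2) * hW - hI
  refine ⟨?_, ?_, ?_⟩
  · rw [← key]
    field_simp
    ring
  · rw [← key]
    field_simp
    ring
  · field_simp
    ring

theorem mainTheorem2 (α : ℝ) (hα : 0 < α) (M : ℝ) (hM : 0 < M ^ 2) (hM1 : M ^ 2 ≠ 1)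
    (ν : ℂ) (hν : ν * (ν + 1) = 3 / 4 - (M : ℂ) ^ 2)
    (l p : ℕ) (m s : ℤ) (hm : |m| ≤ (l : ℤ)) (hs : |s| ≤ (p : ℤ)) (t : ℝ) :
    DeSitter.kgForm α (DeSitter.uMode α ν l m) (DeSitter.uMode α ν p s) t
        = (if l = p ∧ m = s then 1 else 0) ∧
      DeSitter.kgForm α (DeSitter.vMode α ν l m) (DeSitter.vMode α ν p s) t
        = -(if l = p ∧ m = s then 1 else 0) ∧
      DeSitter.kgForm α (DeSitter.uMode α ν l m) (DeSitter.vMode α ν p s) t = 0 := by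
  obtain ⟨μ, rfl⟩ : ∃ μ : ℂ, ν = μ - 1 / 2 := ⟨ν + 1 / 2, by ring⟩
  have hμd : μ ^ 2 = ((1 - M ^ 2 : ℝ) : ℂ) := by
    push_cast
    linear_combination hν
  have hd : 1 - M ^ 2 < 1 := by linarith
  -- The integer `0` is excluded by `M² ≠ 1`, any other because `μ² = 1 - M² < 1`.
  have hμ : ∀ n : ℤ, μ ≠ n := by
    rintro n rfl
    have h : (n : ℝ) ^ 2 = 1 - M ^ 2 := by exact_mod_cast hμd
    rcases eq_or_ne n 0 with rfl | hn
    · apply hM1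
      push_cast at h
      linarith
    · have h1 : (1 : ℤ) ≤ n ^ 2 := by
        have := sq_pos_of_ne_zero hn
        omega
      have h2 : (1 : ℝ) ≤ (n : ℝ) ^ 2 := by exact_mod_cast h1
      linarith
  -- `μ²` is real, so `conj μ` and `μ` have the same square.
  obtain ⟨ε, hε, hμε⟩ : ∃ ε : ℝ, (ε = 1 ∨ ε = -1) ∧ conj μ = ε * μ := by
    have h : conj μ ^ 2 = μ ^ 2 := by rw [← map_pow, hμd, Complex.conj_ofReal]
    rcases sq_eq_sq_iff_eq_or_eq_neg.1 h with h | h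
    · exact ⟨1, Or.inl rfl, by rw [h]; simp⟩
    · exact ⟨-1, Or.inr rfl, by rw [h]; simp⟩
  obtain ⟨U, V, hU, hV, huu, hvv, huv⟩ :=
    exists_hasDerivAt_modeTime_kleinGordon hα hμ hd hμd hε hμε l t
  obtain ⟨U₂, V₂, hU₂, hV₂, -⟩ :=
    exists_hasDerivAt_modeTime_kleinGordon hα hμ hd hμd hε hμε p t
  rw [kgForm_of_separated α hm (uMode_eq hμ α l m) (uMode_eq hμ α p s) hU hU₂,
    kgForm_of_separated α hm (vMode_eq hμ α l m) (vMode_eq hμ α p s) hV hV₂,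
    kgForm_of_separated α hm (uMode_eq hμ α l m) (vMode_eq hμ α p s) hU hV₂]
  split_ifs with h
  · obtain ⟨rfl, rfl⟩ := h
    rw [← hU.unique hU₂, ← hV.unique hV₂, huu, hvv, huv]
    simp
  · simp
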